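/- Let $p:\mathcal E\to\mathcal B$ be a (Grothendieck) fibration with finite products: $\mathcal B$ and every fibre $\mathcal E_X$ have finite products ($\top_X$, $\wedge$), and every reindexing functor $f^*$ preserves them. "Cartesian" and "cocartesian" refer to $p$ and mean the universal property with respect to all factorisations in the base. Products in $\mathcal B$ and in the fibres may be any product diagrams; $\langle i_1,\dots,i_k\rangle$ denotes a list of projections, so that $\langle 1,1\rangle:X\to X\times X$ is the diagonal and an object $X$ is also a product $1\times X$. Let $\Delta$ be the class of parametrised diagonals $\langle1,2,2\rangle:Y\times X\to Y\times X\times X$, for all $Y,X$ in $\mathcal B$. Definitions. * $p$ is *elementary* if for all $Y,X$ the functor $\langle1,2,2\rangle^*:\mathcal E_{Y\times X\times X}\to\mathcal E_{Y\times X}$ has a left adjoint $\Sigma_{Y,X}$ such that the canonical arrows $\Sigma_{Y,X}(\langle1,2,2\rangle^*D\wedge A)\to D\wedge \Sigma_{Y,X}A$ (Frobenius reciprocity) and, for every $f:Y\to Z$ and $A$ over $Z\times X$, $\Sigma_{Y,X}(f\times X)^*A\to(f\times X\times X)^*\Sigma_{Z,X}A$ (Beck–Chevalley) are isomorphisms.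 * Let $\varphi:A\to D$ be over $V\times f:V\times Y\to V\times X$. A *parametrised reindexing* of $\varphi$ along $g:U\to V$ is an arrow $\varphi':A'\to D'$ over $U\times f$ that fits in a commutative square $\varphi\alpha=\beta\varphi'$ with $\alpha:A'\to A$ cartesian over $g\times Y$ and $\beta:D'\to D$ cartesian over $g\times X$. The class $\Phi$ of cocartesian arrows over $\Delta$ is *product-stable* if for all $V,U,g$, every $f\in\Delta$ and every $\varphi\in\Phi$ over $V\times f$, every parametrised reindexing of $\varphi$ along $g$ is in $\Phi$. * $\Phi$ is *pairable* if for every $\varphi:A\to D$ in $\Phi$ and every cartesian $\psi:C'\to C$ over $p(\varphi)$, the arrow $\varphi\wedge\psi=\langle\varphi\pi_1,\psi\pi_2\rangle:A\wedge C'\to D\wedge C$ over $p(\varphi)$ is in $\Phi$. * A *loop* on $X$ is an object $\mathrm{Eq}_X$ over $X\times X$ with an arrow $\delta_X:\top_X\to\mathrm{Eq}_X$ over $\langle1,1\rangle$. For $A$ over $X$ let $\delta_A=\langle\iota,\delta_X{!}\rangle:A\to\langle1\rangle^*A\wedge\mathrm{Eq}_X$ over $\langle1,1\rangle$, where $\iota:A\to\langle1\rangle^*A$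 over $\langle1,1\rangle$ is the section of the cartesian lift $\langle1\rangle^*A\to A$. A *strict transporter* on $X$ is a loop on $X$ together with, for every $A$ over $X$, an arrow $t_A:\langle1\rangle^*A\wedge\mathrm{Eq}_X\to A$ over $\langle2\rangle:X\times X\to X$ with $t_A\delta_A=\mathrm{id}_A$. *Strict productive transporters* consist of a strict transporter on every $X$ such that for all $X,Y$ there is a vertical arrow $\chi:\mathrm{Eq}_X\boxtimes\mathrm{Eq}_Y:=\langle1,3\rangle^*\mathrm{Eq}_X\wedge\langle2,4\rangle^*\mathrm{Eq}_Y\to\mathrm{Eq}_{X\times Y}$ over $X\times Y\times X\times Y$ with $\chi\circ(\delta_X\boxtimes\delta_Y)=\delta_{X\times Y}$, where $\delta_X\boxtimes\delta_Y:\top_{X\times Y}\to\mathrm{Eq}_X\boxtimes\mathrm{Eq}_Y$ is the arrow over the diagonal of $X\times Y$ induced by $\top_{X\times Y}\to\top_X\to\mathrm{Eq}_X$ and $\top_{X\times Y}\to\top_Y\to\mathrm{Eq}_Y$. * For a loop $\delta_X$, the class $\mathrm{BCFR}(\delta_X)$ consists of the arrows $\sigma\wedge\delta':C\wedge A'\to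 C'\wedge D'$ over $U\times\langle1,1\rangle:U\times X\to U\times(X\times X)$, for any object $U$, where $\delta':A'\to D'$ is a parametrised reindexing of $\delta_X$ (viewed as an arrow over $1\times\langle1,1\rangle$) along $U\to1$, and where $\sigma:C\to C'$ and $\rho:C'\to C$ are cartesian over $U\times\langle1,1\rangle$ and $U\times\langle1\rangle$ respectively, with $\rho\sigma=\mathrm{id}_C$. * An arrow $\varphi$ of $\mathcal E$ is *fibred-epic* if $\psi\varphi=\psi'\varphi$ and $p(\psi)=p(\psi')$ imply $\psi=\psi'$. Theorem. The following are equivalent. (i) $p$ is elementary. (ii) Every arrow in $\Delta$ has cocartesian lifts from every object over its domain, and the class of cocartesian arrows over $\Delta$ is product-stable and pairable. (iii) For every $X$ there are an object $\mathrm{Eq}_X$ over $X\times X$ and a cocartesian arrow $\delta_X:\top_X\to\mathrm{Eq}_X$ over $\langle1,1\rangle:X\to X\times X$, and the class of cocartesian arrows over $\Delta$ is product-stable and pairable. (iv) $p$ has strict productive transporters such that, for their loops $\delta_X$, every arrow in $\mathrm{BCFR}(\delta_X)$ is fibred-epic and lies over $\Delta$, for every $X$. (v) There is a loop $\delta_X:\top_X\to\mathrm{Eq}_X$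 on every $X$ such that, for every $X$, every arrow in $\mathrm{BCFR}(\delta_X)$ is cocartesian and lies over $\Delta$. (vi) For every $X$ there is an object $\mathrm{Eq}_X$ over $X\times X$ such that, for all $Y,X$, the functor $A\mapsto(\langle1,2\rangle^*A)\wedge(\langle2,3\rangle^*\mathrm{Eq}_X)$ from $\mathcal E_{Y\times X}$ to $\mathcal E_{Y\times X\times X}$ is left adjoint to $\langle1,2,2\rangle^*:\mathcal E_{Y\times X\times X}\to\mathcal E_{Y\times X}$. -/

import Mathlib

open CategoryTheory CategoryTheory.Limits CategoryTheory.Functor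

namespace ElemFib

universe v₁ v₂ u₁ u₂

section Products

variable {C : Type u₁} [Category.{v₁} C]

/-- `a : P ⟶ A` and `b : P ⟶ A'` exhibit `P` as a (not necessarily chosen) binary product
of `A` and `A'`. -/
def IsBinProd {P A A' : C} (a : P ⟶ A) (b : P ⟶ A') : Prop :=
  Nonempty (IsLimit (BinaryFan.mk a b))

/-- If `(a₁, a₂)` and `(b₁, b₂)` are the projections of two binary products, this says that `k` is
the arrow `f₁ × f₂` between them. -/
def IsProdMap {P P' A₁ A₂ A₁' A₂' : C} (a₁ : P ⟶ A₁) (a₂ : P ⟶ A₂) (b₁ : P' ⟶ A₁') (b₂ : P' ⟶ A₂')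
    (f₁ : A₁ ⟶ A₁') (f₂ : A₂ ⟶ A₂') (k : P ⟶ P') : Prop :=
  k ≫ b₁ = a₁ ≫ f₁ ∧ k ≫ b₂ = a₂ ≫ f₂

/-- The class of parametrised diagonals `⟨1,2,2⟩ : Y × X ⟶ Y × X × X`, for all objects `Y`, `X`
and all product diagrams: the domain `W` is a product of `Y` and `X` with projections `w₁`, `w₂`,
the codomain `Z` is a product of `W` and `X` with projections `z₁₂`, `z₃`, and the arrow is
`⟨𝟙, w₂⟩`. -/
def ParamDiag : MorphismProperty C := fun W Z d =>
  ∃ (Y X : C) (w₁ : W ⟶ Y) (w₂ : W ⟶ X) (z₁₂ : Z ⟶ W) (z₃ : Z ⟶ X),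
    IsBinProd w₁ w₂ ∧ IsBinProd z₁₂ z₃ ∧ d ≫ z₁₂ = 𝟙 W ∧ d ≫ z₃ = w₂

variable [HasFiniteProducts C]

/-- `⟨1,1⟩ : X ⟶ X × X`. -/
noncomputable def dia (X : C) : X ⟶ X ⨯ X := prod.lift (𝟙 X) (𝟙 X)

/-- `⟨1,2,2⟩ : Y × X ⟶ Y × X × X`, for the chosen products. -/
noncomputable def pdia (Y X : C) : Y ⨯ X ⟶ (Y ⨯ X) ⨯ X := prod.lift (𝟙 (Y ⨯ X)) prod.snd

/-- `⟨1,2⟩ : Y × X × X ⟶ Y × X`. -/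
noncomputable def pr12 (Y X : C) : (Y ⨯ X) ⨯ X ⟶ Y ⨯ X := prod.fst

/-- `⟨2,3⟩ : Y × X × X ⟶ X × X`. -/
noncomputable def pr23 (Y X : C) : (Y ⨯ X) ⨯ X ⟶ X ⨯ X := prod.lift (prod.fst ≫ prod.snd) prod.snd

/-- `⟨1,3⟩ : X × Y × X × Y ⟶ X × X`. -/
noncomputable def pr13 (X Y : C) : (X ⨯ Y) ⨯ (X ⨯ Y) ⟶ X ⨯ X := prod.map prod.fst prod.fst

/-- `⟨2,4⟩ : X × Y × X × Y ⟶ Y × Y`. -/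
noncomputable def pr24 (X Y : C) : (X ⨯ Y) ⨯ (X ⨯ Y) ⟶ Y ⨯ Y := prod.map prod.snd prod.snd

end Products

variable {B : Type u₁} [Category.{v₁} B] {E : Type u₂} [Category.{v₂} E] (p : E ⥤ B)

section Fibres

variable {p}

/-- The object of the total category underlying an object of a fibre. -/
abbrev tot {X : B} (A : p.Fiber X) : E := Fiber.fiberInclusion.obj A

/-- The arrow of the total category underlying an arrow of a fibre. -/
abbrev und {X : B} {A A' : p.Fiber X} (φ : A ⟶ A') : tot A ⟶ tot A' := Fiber.fiberInclusion.map φ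

lemma und_ext {X : B} {A A' : p.Fiber X} {φ ψ : A ⟶ A'} (h : und φ = und ψ) : φ = ψ :=
  Fiber.hom_ext h

variable (p)

/-- A vertical arrow of the total category, as an arrow of the fibre. -/
def vert {X : B} {A A' : p.Fiber X} (φ : tot A ⟶ tot A') [h : p.IsHomLift (𝟙 X) φ] : A ⟶ A' :=
  ⟨φ, h⟩

@[simp]
lemma und_vert {X : B} {A A' : p.Fiber X} (φ : tot A ⟶ tot A') [p.IsHomLift (𝟙 X) φ] :
    und (vert p φ) = φ := rfl

instance id_isHomLift {X : B} (A : p.Fiber X) : p.IsHomLift (𝟙 X) (𝟙 (tot A)) := IsHomLift.id A.2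

end Fibres

section Reindexing

variable [p.IsFibered]

/-- The domain of a chosen cartesian lift of `f` into `A`. -/
noncomputable def reindexObj {X Y : B} (f : X ⟶ Y) (A : p.Fiber Y) : p.Fiber X :=
  ⟨IsPreFibered.pullbackObj A.2 f, IsPreFibered.pullbackObj_proj A.2 f⟩

/-- The chosen cartesian lift of `f` into `A`. -/
noncomputable def reindexArr {X Y : B} (f : X ⟶ Y) (A : p.Fiber Y) :
    tot (reindexObj p f A) ⟶ tot A :=
  IsPreFibered.pullbackMap A.2 f

instance reindexArr_isStronglyCartesian {X Y : B} (f : X ⟶ Y) (A : p.Fiber Y) :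
    p.IsStronglyCartesian f (reindexArr p f A) := by
  have : p.IsCartesian f (reindexArr p f A) := IsPreFibered.pullbackMap.IsCartesian A.2 f
  infer_instance

/-- The reindexing functor `f^*` between the fibres. -/
noncomputable def reindex {X Y : B} (f : X ⟶ Y) : p.Fiber Y ⥤ p.Fiber X where
  obj A := reindexObj p f A
  map {A A'} φ := vert p (IsStronglyCartesian.map p f (reindexArr p f A') (g := 𝟙 X)
    (f' := f ≫ 𝟙 Y) (by simp) (reindexArr p f A ≫ und φ))
  map_id A := by
    apply und_ext
    apply IsStronglyCartesian.ext p f (reindexArr p f A) (𝟙 X)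
    simp
  map_comp {A A' A''} φ ψ := by
    apply und_ext
    apply IsStronglyCartesian.ext p f (reindexArr p f A'') (𝟙 X)
    simp only [und_vert, Functor.map_comp, IsStronglyCartesian.fac, Category.assoc]
    rw [← Category.assoc, ← Category.assoc, IsStronglyCartesian.fac]

/-- The chosen cartesian lift of `f` into `A`, as an arrow from `f^* A`. -/
noncomputable def cart {X Y : B} (f : X ⟶ Y) (A : p.Fiber Y) : tot ((reindex p f).obj A) ⟶ tot A :=
  reindexArr p f A

instance cart_isStronglyCartesian {X Y : B} (f : X ⟶ Y) (A : p.Fiber Y) :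
    p.IsStronglyCartesian f (cart p f A) :=
  reindexArr_isStronglyCartesian p f A

/-- The arrow over `g` into `f^* A` induced by an arrow `φ` over `h = g ≫ f` into `A`. -/
noncomputable def cartLift {W X Y : B} {g : W ⟶ X} {f : X ⟶ Y} {h : W ⟶ Y} (w : h = g ≫ f)
    {c : E} (A : p.Fiber Y) (φ : c ⟶ tot A) [p.IsHomLift h φ] : c ⟶ tot ((reindex p f).obj A) :=
  IsStronglyCartesian.map p f (cart p f A) w φ

instance cartLift_isHomLift {W X Y : B} {g : W ⟶ X} {f : X ⟶ Y} {h : W ⟶ Y} (w : h = g ≫ f)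
    {c : E} (A : p.Fiber Y) (φ : c ⟶ tot A) [p.IsHomLift h φ] :
    p.IsHomLift g (cartLift p w A φ) :=
  IsStronglyCartesian.map_isHomLift p f (cart p f A) w φ

@[simp]
lemma cartLift_cart {W X Y : B} {g : W ⟶ X} {f : X ⟶ Y} {h : W ⟶ Y} (w : h = g ≫ f)
    {c : E} (A : p.Fiber Y) (φ : c ⟶ tot A) [p.IsHomLift h φ] :
    cartLift p w A φ ≫ cart p f A = φ :=
  IsStronglyCartesian.fac p f (cart p f A) w φ

lemma cart_hom_ext {W X Y : B} (g : W ⟶ X) (f : X ⟶ Y) {c : E} (A : p.Fiber Y)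
    (ψ ψ' : c ⟶ tot ((reindex p f).obj A)) [p.IsHomLift g ψ] [p.IsHomLift g ψ']
    (h : ψ ≫ cart p f A = ψ' ≫ cart p f A) : ψ = ψ' :=
  IsStronglyCartesian.ext p f (cart p f A) g h

/-- The vertical arrow `C ⟶ f^* A` induced by an arrow `φ : C ⟶ A` over `f`. -/
noncomputable def cartVert {X Y : B} (f : X ⟶ Y) {C : p.Fiber X} (A : p.Fiber Y) (φ : tot C ⟶ tot A)
    [p.IsHomLift f φ] : C ⟶ (reindex p f).obj A :=
  vert p (cartLift p (g := 𝟙 X) (f := f) (h := f) (by simp) A φ)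

@[simp]
lemma und_cartVert_cart {X Y : B} (f : X ⟶ Y) {C : p.Fiber X} (A : p.Fiber Y) (φ : tot C ⟶ tot A)
    [p.IsHomLift f φ] : und (cartVert p f A φ) ≫ cart p f A = φ := by
  simp [cartVert]

lemma cart_und {X Y : B} (f : X ⟶ Y) {A A' : p.Fiber Y} (φ : A ⟶ A') :
    cart p f A ≫ und φ = und ((reindex p f).map φ) ≫ cart p f A' := by
  exact (IsStronglyCartesian.fac p f (reindexArr p f A') (g := 𝟙 X) (f' := f ≫ 𝟙 Y) (by simp)
    (reindexArr p f A ≫ und φ)).symm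

/-- The vertical arrow `c^* d^* D ⟶ a^* b^* D` compatible with the cartesian lifts, for a
commutative square `a ≫ b = c ≫ d` in the base. -/
noncomputable def reindexSq {W X Y Z : B} {a : W ⟶ X} {b : X ⟶ Z} {c : W ⟶ Y} {d : Y ⟶ Z}
    (w : a ≫ b = c ≫ d) (D : p.Fiber Z) :
    (reindex p c).obj ((reindex p d).obj D) ⟶ (reindex p a).obj ((reindex p b).obj D) :=
  vert p (cartLift p (g := 𝟙 W) (f := a) (h := a) (by simp) _
      (cartLift p (g := a) (f := b) (h := c ≫ d) w.symm D
        (cart p c ((reindex p d).obj D) ≫ cart p d D)))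

end Reindexing

/-- The fibres of the fibration have finite products and reindexing preserves them; a fibration
over a base with finite products which satisfies this is a fibration with finite products. -/
class HasFibredProducts [p.IsFibered] : Prop where
  fibre : ∀ X : B, HasFiniteProducts (p.Fiber X)
  preserves : ∀ {X Y : B} (f : X ⟶ Y), PreservesFiniteProducts (reindex p f)

attribute [instance] HasFibredProducts.fibre HasFibredProducts.preserves

section Pairing

variable [p.IsFibered] [HasFibredProducts p]

/-- The arrow `⟨φ, φ'⟩ : C ⟶ A ∧ A'` over `f` induced by two arrows over `f`. -/
noncomputable def pair {X Y : B} (f : X ⟶ Y) {C : p.Fiber X} {A A' : p.Fiber Y} (φ : tot C ⟶ tot A)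
    (φ' : tot C ⟶ tot A') [p.IsHomLift f φ] [p.IsHomLift f φ'] : tot C ⟶ tot (A ⨯ A') :=
  und (prod.lift (cartVert p f A φ) (cartVert p f A' φ') ≫
    (PreservesLimitPair.iso (reindex p f) A A').inv) ≫ cart p f (A ⨯ A')

/-- The arrow `A ⟶ ⊤` over `f` into the terminal object of the fibre over the codomain of `f`. -/
noncomputable def toTop {X Y : B} (f : X ⟶ Y) (A : p.Fiber X) : tot A ⟶ tot (⊤_ (p.Fiber Y)) :=
  und (terminal.from A ≫ (PreservesTerminal.iso (reindex p f)).inv) ≫ cart p f (⊤_ (p.Fiber Y))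

instance pair_isHomLift {X Y : B} (f : X ⟶ Y) {C : p.Fiber X} {A A' : p.Fiber Y} (φ : tot C ⟶ tot A)
    (φ' : tot C ⟶ tot A') [p.IsHomLift f φ] [p.IsHomLift f φ'] : p.IsHomLift f (pair p f φ φ') := by
  have h : p.IsHomLift (𝟙 X ≫ f) (pair p f φ φ') := by unfold pair; infer_instance
  rwa [Category.id_comp] at h

instance toTop_isHomLift {X Y : B} (f : X ⟶ Y) (A : p.Fiber X) :
    p.IsHomLift f (toTop p f A) := by
  have h : p.IsHomLift (𝟙 X ≫ f) (toTop p f A) := by unfold toTop; infer_instance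
  rwa [Category.id_comp] at h

lemma pair_fst {X Y : B} (f : X ⟶ Y) {C : p.Fiber X} {A A' : p.Fiber Y} (φ : tot C ⟶ tot A)
    (φ' : tot C ⟶ tot A') [p.IsHomLift f φ] [p.IsHomLift f φ'] :
    pair p f φ φ' ≫ und prod.fst = φ := by
  have h : (PreservesLimitPair.iso (reindex p f) A A').inv ≫ (reindex p f).map prod.fst
      = prod.fst := by
    rw [Iso.inv_comp_eq, PreservesLimitPair.iso_hom, prodComparison_fst]
  rw [pair, Category.assoc, cart_und, ← Category.assoc, ← Functor.map_comp, Category.assoc, h,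
    prod.lift_fst]
  exact und_cartVert_cart p f A φ

lemma pair_snd {X Y : B} (f : X ⟶ Y) {C : p.Fiber X} {A A' : p.Fiber Y} (φ : tot C ⟶ tot A)
    (φ' : tot C ⟶ tot A') [p.IsHomLift f φ] [p.IsHomLift f φ'] :
    pair p f φ φ' ≫ und prod.snd = φ' := by
  have h : (PreservesLimitPair.iso (reindex p f) A A').inv ≫ (reindex p f).map prod.snd
      = prod.snd := by
    rw [Iso.inv_comp_eq, PreservesLimitPair.iso_hom, prodComparison_snd]
  rw [pair, Category.assoc, cart_und, ← Category.assoc, ← Functor.map_comp, Category.assoc, h,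
    prod.lift_snd]
  exact und_cartVert_cart p f A' φ'

end Pairing

section Classes

/-- The class of cocartesian arrows lying over arrows of the class `Θ`. -/
def cocartOver (Θ : MorphismProperty B) : MorphismProperty E := fun _ _ φ =>
  p.IsStronglyCocartesian (p.map φ) φ ∧ Θ (p.map φ)

/-- Arrows that are epic with respect to parallel pairs with the same image in the base. -/
def fibEpic : MorphismProperty E := fun _ b φ =>
  ∀ {b' : E} (ψ ψ' : b ⟶ b'), p.map ψ = p.map ψ' → φ ≫ ψ = φ ≫ ψ' → ψ = ψ'

/-- Every arrow of `Θ` has cocartesian lifts from every object over its domain. -/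
def HasCocartLifts (Θ : MorphismProperty B) : Prop :=
  ∀ {X Y : B} (f : X ⟶ Y), Θ f → ∀ A : p.Fiber X,
    ∃ (D : p.Fiber Y) (φ : tot A ⟶ tot D), p.IsStronglyCocartesian f φ

/-- The class `Φ` is stable under parametrised reindexing of arrows over `V × f` with `f` in `Θ`:
for every commutative square `α ≫ φ = φ' ≫ β` in the total category, with `α` and `β` cartesian,
over the square formed by `V × f`, `U × f`, `g × Y` and `g × X`, if `φ` is in `Φ` then so
is `φ'`. -/
def ProductStable (Θ : MorphismProperty B) (Φ : MorphismProperty E) : Prop :=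
  ∀ {U V Y X : B} (g : U ⟶ V) (f : Y ⟶ X), Θ f →
  ∀ {UY VY UX VX : B}
    (a₁ : UY ⟶ U) (a₂ : UY ⟶ Y) (b₁ : VY ⟶ V) (b₂ : VY ⟶ Y)
    (c₁ : UX ⟶ U) (c₂ : UX ⟶ X) (d₁ : VX ⟶ V) (d₂ : VX ⟶ X),
    IsBinProd a₁ a₂ → IsBinProd b₁ b₂ → IsBinProd c₁ c₂ → IsBinProd d₁ d₂ →
  ∀ (gY : UY ⟶ VY) (gX : UX ⟶ VX) (Uf : UY ⟶ UX) (Vf : VY ⟶ VX),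
    IsProdMap a₁ a₂ b₁ b₂ g (𝟙 Y) gY → IsProdMap c₁ c₂ d₁ d₂ g (𝟙 X) gX →
    IsProdMap a₁ a₂ c₁ c₂ (𝟙 U) f Uf → IsProdMap b₁ b₂ d₁ d₂ (𝟙 V) f Vf →
  ∀ {A' A D' D : E} (φ' : A' ⟶ D') (φ : A ⟶ D) (α : A' ⟶ A) (β : D' ⟶ D),
    p.IsHomLift Uf φ' → p.IsHomLift Vf φ →
    p.IsStronglyCartesian gY α → p.IsStronglyCartesian gX β →
    α ≫ φ = φ' ≫ β → Φ φ → Φ φ'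

/-- The class `Φ` is closed under `φ ↦ φ ∧ ψ` for `ψ` cartesian over the same arrow `f` as `φ`;
the products are taken in the fibres. -/
def Pairable (Φ : MorphismProperty E) : Prop :=
  ∀ {X Y : B} (f : X ⟶ Y) {A C' P : p.Fiber X} {D C Q : p.Fiber Y}
    (φ : tot A ⟶ tot D) (ψ : tot C' ⟶ tot C) (π₁ : P ⟶ A) (π₂ : P ⟶ C') (π₁' : Q ⟶ D) (π₂' : Q ⟶ C)
    (χ : tot P ⟶ tot Q),
    p.IsHomLift f φ → p.IsStronglyCartesian f ψ → IsBinProd π₁ π₂ → IsBinProd π₁' π₂' →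
    p.IsHomLift f χ → χ ≫ und π₁' = und π₁ ≫ φ → χ ≫ und π₂' = und π₂ ≫ ψ →
    Φ φ → Φ χ

/-- Let `s ≫ r = 𝟙` be a retraction pair in the base, let `W` and `Z` be products `V × X` and
`V × Y` with projections `w₁, w₂` and `z₁, z₂`, and let `φ : A ⟶ D` be an arrow over `V × s`.
This is the class of the arrows `ψ` obtained from `φ` by a parametrised reindexing `φ'` along some
`g : U ⟶ V` followed by a split pairing `ψ = σ ∧ φ' : C ∧ A' ⟶ C' ∧ D'`. -/
inductive BCFR {V X Y W Z : B} (s : X ⟶ Y) (r : Y ⟶ X) (w₁ : W ⟶ V) (w₂ : W ⟶ X)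
    (z₁ : Z ⟶ V) (z₂ : Z ⟶ Y) {A : p.Fiber W} {D : p.Fiber Z} (φ : tot A ⟶ tot D) :
    ∀ {a b : E}, (a ⟶ b) → Prop
  | mk {U UX UY : B} (g : U ⟶ V)
      (x₁ : UX ⟶ U) (x₂ : UX ⟶ X) (y₁ : UY ⟶ U) (y₂ : UY ⟶ Y)
      (hx : IsBinProd x₁ x₂) (hy : IsBinProd y₁ y₂)
      (gX : UX ⟶ W) (gY : UY ⟶ Z) (Us : UX ⟶ UY) (Ur : UY ⟶ UX)
      (hgX : IsProdMap x₁ x₂ w₁ w₂ g (𝟙 X) gX) (hgY : IsProdMap y₁ y₂ z₁ z₂ g (𝟙 Y) gY)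
      (hUs : IsProdMap x₁ x₂ y₁ y₂ (𝟙 U) s Us) (hUr : IsProdMap y₁ y₂ x₁ x₂ (𝟙 U) r Ur)
      {A' C P : p.Fiber UX} {D' C' Q : p.Fiber UY}
      (α : tot A' ⟶ tot A) (β : tot D' ⟶ tot D) (φ' : tot A' ⟶ tot D')
      (hα : p.IsStronglyCartesian gX α) (hβ : p.IsStronglyCartesian gY β)
      (hφ' : p.IsHomLift Us φ') (comm : α ≫ φ = φ' ≫ β)
      (σ : tot C ⟶ tot C') (ρ : tot C' ⟶ tot C)
      (hσ : p.IsStronglyCartesian Us σ) (hρ : p.IsStronglyCartesian Ur ρ) (split : σ ≫ ρ = 𝟙 (tot C))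
      (π₁ : P ⟶ C) (π₂ : P ⟶ A') (π₁' : Q ⟶ C') (π₂' : Q ⟶ D')
      (hP : IsBinProd π₁ π₂) (hQ : IsBinProd π₁' π₂')
      (ψ : tot P ⟶ tot Q) (hψ : p.IsHomLift Us ψ)
      (h₁ : ψ ≫ und π₁' = und π₁ ≫ σ) (h₂ : ψ ≫ und π₂' = und π₂ ≫ φ') :
      BCFR s r w₁ w₂ z₁ z₂ φ ψ

end Classes

section Elementary

variable [HasFiniteProducts B] [p.IsFibered] [HasFibredProducts p]

/-- The canonical arrow `L (f^* D ∧ A) ⟶ D ∧ L A` for `L` left adjoint to reindexing along `f`. -/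
noncomputable def frobenius {X Y : B} {f : X ⟶ Y} {L : p.Fiber X ⥤ p.Fiber Y}
    (adj : L ⊣ reindex p f) (D : p.Fiber Y) (A : p.Fiber X) :
    L.obj ((reindex p f).obj D ⨯ A) ⟶ D ⨯ L.obj A :=
  prod.lift (L.map prod.fst ≫ adj.counit.app D) (L.map prod.snd)

/-- The canonical arrow `L c^* A ⟶ b^* L' A` for a commutative square `a ≫ b = c ≫ d` in the base,
with `L` left adjoint to `a^*` and `L'` left adjoint to `d^*`. -/
noncomputable def beckChevalley {W X Y Z : B} {a : W ⟶ X} {b : X ⟶ Z} {c : W ⟶ Y} {d : Y ⟶ Z}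
    (w : a ≫ b = c ≫ d) {L : p.Fiber W ⥤ p.Fiber X} {L' : p.Fiber Y ⥤ p.Fiber Z}
    (adj : L ⊣ reindex p a) (adj' : L' ⊣ reindex p d) (A : p.Fiber Y) :
    L.obj ((reindex p c).obj A) ⟶ (reindex p b).obj (L'.obj A) :=
  (adj.homEquiv _ _).symm ((reindex p c).map (adj'.unit.app A) ≫ reindexSq p w (L'.obj A))

lemma pdia_square {Y Z : B} (f : Y ⟶ Z) (X : B) :
    pdia Y X ≫ prod.map (prod.map f (𝟙 X)) (𝟙 X) = prod.map f (𝟙 X) ≫ pdia Z X := by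
  ext <;> simp [pdia]

/-- Elementary fibrations: reindexing along the parametrised diagonals has left adjoints that
satisfy Frobenius reciprocity and the Beck–Chevalley condition. -/
def IsElementary : Prop :=
  ∃ (L : ∀ Y X : B, p.Fiber (Y ⨯ X) ⥤ p.Fiber ((Y ⨯ X) ⨯ X))
    (adj : ∀ Y X : B, L Y X ⊣ reindex p (pdia Y X)),
    (∀ (Y X : B) (A : p.Fiber (Y ⨯ X)) (D : p.Fiber ((Y ⨯ X) ⨯ X)),
      IsIso (frobenius p (adj Y X) D A)) ∧
    (∀ (Y Z X : B) (f : Y ⟶ Z) (A : p.Fiber (Z ⨯ X)),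
      IsIso (beckChevalley p (pdia_square f X) (adj Y X) (adj Z X) A))

end Elementary

section Transporters

variable [HasFiniteProducts B] [p.IsFibered] [HasFibredProducts p]

/-- A loop on `X`: an object `Eq_X` over `X × X` and an arrow `⊤_X ⟶ Eq_X` over the diagonal. -/
structure Loop (X : B) where
  obj : p.Fiber (X ⨯ X)
  arr : tot (⊤_ (p.Fiber X)) ⟶ tot obj
  arr_isHomLift : p.IsHomLift (dia X) arr

attribute [instance] Loop.arr_isHomLift

variable {p}

/-- The object `pr₁^* A ∧ Eq_X` over `X × X`. -/
noncomputable def Loop.act {X : B} (l : Loop p X) (A : p.Fiber X) : p.Fiber (X ⨯ X) :=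
  (reindex p prod.fst).obj A ⨯ l.obj

/-- The cartesian arrow `A ⟶ pr₁^* A` over the diagonal: the section of `pr₁^* A ⟶ A`. -/
noncomputable def diaLift {X : B} (A : p.Fiber X) :
    tot A ⟶ tot ((reindex p (prod.fst : X ⨯ X ⟶ X)).obj A) :=
  cartLift p (g := dia X) (h := 𝟙 X) (prod.lift_fst _ _).symm A (𝟙 (tot A))

instance diaLift_isHomLift {X : B} (A : p.Fiber X) : p.IsHomLift (dia X) (diaLift A) := by
  unfold diaLift; exact cartLift_isHomLift p _ _ _

/-- The arrow `A ⟶ ⊤_X ⟶ Eq_X`. -/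
noncomputable def Loop.reflAt {X : B} (l : Loop p X) (A : p.Fiber X) : tot A ⟶ tot l.obj :=
  und (terminal.from A) ≫ l.arr

instance Loop.reflAt_isHomLift {X : B} (l : Loop p X) (A : p.Fiber X) :
    p.IsHomLift (dia X) (l.reflAt A) := by
  have h : p.IsHomLift (𝟙 X ≫ dia X) (l.reflAt A) := by unfold Loop.reflAt; infer_instance
  rwa [Category.id_comp] at h

/-- The arrow `δ_A : A ⟶ pr₁^* A ∧ Eq_X` over the diagonal. -/
noncomputable def Loop.point {X : B} (l : Loop p X) (A : p.Fiber X) : tot A ⟶ tot (l.act A) :=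
  pair p (dia X) (diaLift A) (l.reflAt A)

/-- The class of arrows obtained from the loop `⊤_X ⟶ Eq_X` by parametrised reindexing along some
`U ⟶ 1` (where `X` is viewed as `1 × X` and `X × X` as `1 × (X × X)`) and split pairing with respect
to the retraction pair `pr₁ : X × X ⟶ X`, `⟨1,1⟩ : X ⟶ X × X`. -/
def Loop.BCFRClass {X : B} (l : Loop p X) : MorphismProperty E := fun _ _ ψ =>
  BCFR p (V := ⊤_ B) (dia X) prod.fst (terminal.from X) (𝟙 X) (terminal.from (X ⨯ X)) (𝟙 (X ⨯ X))
    l.arr ψ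

variable (p)

/-- A strict transporter on `X`: a loop with, for every `A` over `X`, a strict carrier
`pr₁^* A ∧ Eq_X ⟶ A` over `pr₂`. -/
structure StrictTransporter (X : B) extends Loop p X where
  carrier : ∀ A : p.Fiber X, tot (toLoop.act A) ⟶ tot A
  carrier_isHomLift : ∀ A : p.Fiber X, p.IsHomLift (prod.snd : X ⨯ X ⟶ X) (carrier A)
  strict : ∀ A : p.Fiber X, toLoop.point A ≫ carrier A = 𝟙 (tot A)

variable {p}

/-- The object `Eq_X ⊠ Eq_Y = ⟨1,3⟩^* Eq_X ∧ ⟨2,4⟩^* Eq_Y` over `(X × Y) × (X × Y)`. -/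
noncomputable def Loop.box {X Y : B} (l : Loop p X) (m : Loop p Y) :
    p.Fiber ((X ⨯ Y) ⨯ (X ⨯ Y)) :=
  (reindex p (pr13 X Y)).obj l.obj ⨯ (reindex p (pr24 X Y)).obj m.obj

/-- The arrow `⊤_{X × Y} ⟶ ⟨1,3⟩^* Eq_X` over the diagonal induced by `⊤_{X × Y} ⟶ ⊤_X ⟶ Eq_X`. -/
noncomputable def Loop.boxFst {X : B} (l : Loop p X) (Y : B) :
    tot (⊤_ (p.Fiber (X ⨯ Y))) ⟶ tot ((reindex p (pr13 X Y)).obj l.obj) :=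
  cartLift p (g := dia (X ⨯ Y)) (f := pr13 X Y) (h := prod.fst ≫ dia X)
    (by ext <;> simp [dia, pr13]) l.obj (toTop p prod.fst (⊤_ (p.Fiber (X ⨯ Y))) ≫ l.arr)

/-- The arrow `⊤_{X × Y} ⟶ ⟨2,4⟩^* Eq_Y` over the diagonal induced by `⊤_{X × Y} ⟶ ⊤_Y ⟶ Eq_Y`. -/
noncomputable def Loop.boxSnd (X : B) {Y : B} (m : Loop p Y) :
    tot (⊤_ (p.Fiber (X ⨯ Y))) ⟶ tot ((reindex p (pr24 X Y)).obj m.obj) :=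
  cartLift p (g := dia (X ⨯ Y)) (f := pr24 X Y) (h := prod.snd ≫ dia Y)
    (by ext <;> simp [dia, pr24]) m.obj (toTop p prod.snd (⊤_ (p.Fiber (X ⨯ Y))) ≫ m.arr)

instance Loop.boxFst_isHomLift {X : B} (l : Loop p X) (Y : B) :
    p.IsHomLift (dia (X ⨯ Y)) (l.boxFst Y) := by
  unfold Loop.boxFst; exact cartLift_isHomLift p _ _ _

instance Loop.boxSnd_isHomLift (X : B) {Y : B} (m : Loop p Y) :
    p.IsHomLift (dia (X ⨯ Y)) (Loop.boxSnd X m) := by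
  unfold Loop.boxSnd; exact cartLift_isHomLift p _ _ _

/-- The arrow `δ_X ⊠ δ_Y : ⊤_{X × Y} ⟶ Eq_X ⊠ Eq_Y` over the diagonal of `X × Y`. -/
noncomputable def Loop.boxArr {X Y : B} (l : Loop p X) (m : Loop p Y) :
    tot (⊤_ (p.Fiber (X ⨯ Y))) ⟶ tot (l.box m) :=
  pair p (dia (X ⨯ Y)) (l.boxFst Y) (Loop.boxSnd X m)

/-- A family of loops is strictly productive when there are vertical arrows
`Eq_X ⊠ Eq_Y ⟶ Eq_{X × Y}` compatible with the loops. -/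
def StrictlyProductive (l : ∀ X : B, Loop p X) : Prop :=
  ∀ X Y : B, ∃ χ : (l X).box (l Y) ⟶ (l (X ⨯ Y)).obj,
    (l X).boxArr (l Y) ≫ und χ = (l (X ⨯ Y)).arr

/-- The functor `A ↦ ⟨1,2⟩^* A ∧ ⟨2,3⟩^* Q` from the fibre over `Y × X` to the fibre over
`Y × X × X`, for `Q` over `X × X`. -/
noncomputable def eqFunctor (Y : B) {X : B} (Q : p.Fiber (X ⨯ X)) :
    p.Fiber (Y ⨯ X) ⥤ p.Fiber ((Y ⨯ X) ⨯ X) :=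
  reindex p (pr12 Y X) ⋙ prod.functor.flip.obj ((reindex p (pr23 Y X)).obj Q)

end Transporters

end ElemFib

/-!
Call a loop on `X` universal if, for all parameters `U` and all `A` over `U × X`, the arrow
`A ⟶ ⟨1,2⟩^* A ∧ ⟨2,3⟩^* Eq_X` over `⟨1,2,2⟩` given by reflexivity is cocartesian. Up to isomorphism
these arrows are the members of `BCFR(δ_X)`, and each of the six conditions amounts to the existence
of a universal loop on every object.

A universal loop gives transport `A(x) ⟶ A(y)` along equalities of `x` and `y` and symmetry of
equality; by uniqueness, transport along an equality is invertible, with inverse the transport along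
its reverse. Invertibility yields pairability and the Frobenius isomorphisms, while transport in one
variable after the other yields productivity. In the converse direction, elementarity provides the
candidate `Σ ⊤` for `Eq_X`, Frobenius reciprocity writes `Σ A` as `⟨1,2⟩^* A ∧ Σ ⊤`, and
Beck–Chevalley removes the dependence of `Σ ⊤` on the parameter. For strict productive transporters,
an arrow `A ⟶ G` over `⟨1,2,2⟩` is extended along the reflexivity of `A` by transport in `G` along
an equality on `(U × X) × X`, and fibred-epicness gives uniqueness. An adjunction as in the
last condition yields a universal point of `Eq_X`, and transport shows that every other point is
then universal too.
-/

namespace ElemFib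

universe v₁ v₂ u₁ u₂

attribute [local simp] prod.lift_fst prod.lift_fst_assoc prod.lift_snd prod.lift_snd_assoc

section BinProd

variable {C : Type u₁} [Category.{v₁} C]

namespace IsBinProd

variable {P A A' : C} {a : P ⟶ A} {b : P ⟶ A'}

lemma of_exists_lift
    (ex : ∀ {T : C} (f : T ⟶ A) (g : T ⟶ A'), ∃ h : T ⟶ P, h ≫ a = f ∧ h ≫ b = g)
    (uniq : ∀ {T : C} (h h' : T ⟶ P), h ≫ a = h' ≫ a → h ≫ b = h' ≫ b → h = h') :
    IsBinProd a b := by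
  choose l hl using @ex
  exact ⟨BinaryFan.IsLimit.mk _ (fun f g => l f g) (fun f g => (hl f g).1) (fun f g => (hl f g).2)
    (fun f g m h₁ h₂ => uniq _ _ (h₁.trans (hl f g).1.symm) (h₂.trans (hl f g).2.symm))⟩

/-- The arrow into a binary product induced by its components. -/
noncomputable def lift (h : IsBinProd a b) {T : C} (f : T ⟶ A) (g : T ⟶ A') : T ⟶ P :=
  BinaryFan.IsLimit.lift' h.some f g |>.1

@[simp]
lemma lift_fst (h : IsBinProd a b) {T : C} (f : T ⟶ A) (g : T ⟶ A') : h.lift f g ≫ a = f :=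
  (BinaryFan.IsLimit.lift' h.some f g).2.1

@[simp]
lemma lift_fst_assoc (h : IsBinProd a b) {T S : C} (f : T ⟶ A) (g : T ⟶ A') (k : A ⟶ S) :
    h.lift f g ≫ a ≫ k = f ≫ k := by
  rw [← Category.assoc, lift_fst]

@[simp]
lemma lift_snd (h : IsBinProd a b) {T : C} (f : T ⟶ A) (g : T ⟶ A') : h.lift f g ≫ b = g :=
  (BinaryFan.IsLimit.lift' h.some f g).2.2

@[simp]
lemma lift_snd_assoc (h : IsBinProd a b) {T S : C} (f : T ⟶ A) (g : T ⟶ A') (k : A' ⟶ S) :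
    h.lift f g ≫ b ≫ k = g ≫ k := by
  rw [← Category.assoc, lift_snd]

lemma hom_ext (h : IsBinProd a b) {T : C} {f g : T ⟶ P} (h₁ : f ≫ a = g ≫ a)
    (h₂ : f ≫ b = g ≫ b) : f = g :=
  BinaryFan.IsLimit.hom_ext h.some h₁ h₂

@[simp]
lemma comp_lift (h : IsBinProd a b) {T S : C} (k : S ⟶ T) (f : T ⟶ A) (g : T ⟶ A') :
    k ≫ h.lift f g = h.lift (k ≫ f) (k ≫ g) :=
  h.hom_ext (by simp) (by simp)

@[simp]
lemma lift_comp (h : IsBinProd a b) {T : C} (k : T ⟶ P) : h.lift (k ≫ a) (k ≫ b) = k :=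
  h.hom_ext (by simp) (by simp)

lemma symm (h : IsBinProd a b) : IsBinProd b a :=
  of_exists_lift (fun f g => ⟨h.lift g f, by simp, by simp⟩) fun _ _ h₁ h₂ => h.hom_ext h₂ h₁

lemma comp_iso (h : IsBinProd a b) {S : C} (i : A ≅ S) : IsBinProd (a ≫ i.hom) b :=
  of_exists_lift (fun f g => ⟨h.lift (f ≫ i.inv) g, by simp, by simp⟩) fun _ _ h₁ h₂ =>
    h.hom_ext ((cancel_mono i.hom).1 (by simpa using h₁)) h₂

lemma assoc_right (h : IsBinProd a b) {U W Z : C} {w₁ : W ⟶ U} {w : W ⟶ A} (hw : IsBinProd w₁ w)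
    {z₁ : Z ⟶ U} {z₂ : Z ⟶ P} (hz : IsBinProd z₁ z₂) {e : Z ⟶ W} (h₁ : e ≫ w₁ = z₁)
    (h₂ : e ≫ w = z₂ ≫ a) : IsBinProd e (z₂ ≫ b) := by
  refine of_exists_lift (fun f g => ⟨hz.lift (f ≫ w₁) (h.lift (f ≫ w) g), hw.hom_ext ?_ ?_, ?_⟩)
    fun k k' e₁ e₂ => hz.hom_ext ?_ (h.hom_ext ?_ ?_)
  · simp [h₁]
  · simp [h₂]
  · simp
  · rw [← h₁, reassoc_of% e₁]
  · rw [Category.assoc, Category.assoc, ← h₂, reassoc_of% e₁]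
  · simpa using e₂

section

variable [HasFiniteProducts C]

lemma of_prod (A A' : C) : IsBinProd (prod.fst : A ⨯ A' ⟶ A) (prod.snd : A ⨯ A' ⟶ A') :=
  ⟨prodIsProd A A'⟩

lemma of_terminal (A : C) : IsBinProd (terminal.from A) (𝟙 A) :=
  of_exists_lift (fun f g => ⟨g, Subsingleton.elim _ _, by simp⟩) fun _ _ _ h => by simpa using h

variable {U X W Z : C} {w₁ : W ⟶ U} {w : W ⟶ X} {e : Z ⟶ W}

lemma assoc_left (hw : IsBinProd w₁ w) {z : Z ⟶ X} (hz : IsBinProd e z) :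
    IsBinProd (e ≫ w₁) (prod.lift (e ≫ w) z) := by
  refine of_exists_lift
    (fun f g => ⟨hz.lift (hw.lift f (g ≫ prod.fst)) (g ≫ prod.snd), by simp, by ext <;> simp⟩)
    fun h h' e₁ e₂ => hz.hom_ext (hw.hom_ext ?_ ?_) ?_
  · simpa using e₁
  · simpa using congrArg (· ≫ prod.fst) e₂
  · simpa using congrArg (· ≫ prod.snd) e₂

end

end IsBinProd

section Dia

variable [HasFiniteProducts C]

@[simp]
lemma comp_dia {W X : C} (w : W ⟶ X) : w ≫ dia X = prod.lift w w := by
  simp [dia]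

end Dia

end BinProd

variable {B : Type u₁} [Category.{v₁} B] {E : Type u₂} [Category.{v₂} E] {p : E ⥤ B}

section HomOver

/-- The arrows `A ⟶ D` of the total category over `f`. Bundling the arrow with its image in the
base makes equations between arrows over propositionally equal arrows of the base statements about
`HomOver.hom`. -/
@[ext]
structure HomOver {X Y : B} (f : X ⟶ Y) (A : p.Fiber X) (D : p.Fiber Y) where
  hom : tot A ⟶ tot D
  isHomLift : p.IsHomLift f hom

attribute [instance] HomOver.isHomLift

namespace HomOver

variable {X Y Z : B} {f f' : X ⟶ Y} {A : p.Fiber X} {D : p.Fiber Y} {G : p.Fiber Z}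

/-- Composition of arrows over composable arrows of the base. -/
def comp {g : Y ⟶ Z} (φ : HomOver f A D) (ψ : HomOver g D G) : HomOver (f ≫ g) A G :=
  ⟨φ.hom ≫ ψ.hom, inferInstance⟩

@[simp]
lemma comp_hom {g : Y ⟶ Z} (φ : HomOver f A D) (ψ : HomOver g D G) :
    (φ.comp ψ).hom = φ.hom ≫ ψ.hom := rfl

/-- The identity, as an arrow over the identity. -/
def id (A : p.Fiber X) : HomOver (𝟙 X) A A := ⟨𝟙 _, inferInstance⟩

@[simp]
lemma id_hom (A : p.Fiber X) : (HomOver.id A).hom = 𝟙 (tot A) := rfl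

/-- Change of the arrow of the base along an equality. -/
def cast (φ : HomOver f A D) (h : f = f' := by simp) : HomOver f' A D := ⟨φ.hom, h ▸ φ.isHomLift⟩

@[simp]
lemma cast_hom (φ : HomOver f A D) (h : f = f') : (φ.cast h).hom = φ.hom := rfl

/-- The inverse of an isomorphism of the total category. -/
noncomputable def inv (φ : HomOver f A D) [IsIso f] [IsIso φ.hom] : HomOver (inv f) D A :=
  ⟨CategoryTheory.inv φ.hom, inferInstance⟩

@[simp]
lemma inv_hom (φ : HomOver f A D) [IsIso f] [IsIso φ.hom] :
    φ.inv.hom = CategoryTheory.inv φ.hom := rfl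

instance (φ : HomOver f A D) [IsIso f] [IsIso φ.hom] : IsIso φ.inv.hom :=
  inferInstanceAs (IsIso (CategoryTheory.inv φ.hom))

/-- An arrow of a fibre, as an arrow over the identity. -/
def ofFiber {A A' : p.Fiber X} (φ : A ⟶ A') : HomOver (𝟙 X) A A' := ⟨und φ, inferInstance⟩

@[simp]
lemma ofFiber_hom {A A' : p.Fiber X} (φ : A ⟶ A') : (ofFiber φ).hom = und φ := rfl

/-- An arrow over the identity, as an arrow of a fibre. -/
def toFiber {A A' : p.Fiber X} (φ : HomOver (𝟙 X) A A') : A ⟶ A' := vert p φ.hom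

@[simp]
lemma und_toFiber {A A' : p.Fiber X} (φ : HomOver (𝟙 X) A A') : und φ.toFiber = φ.hom := rfl

/-- Cartesian arrows. -/
def IsCart (φ : HomOver f A D) : Prop := p.IsStronglyCartesian f φ.hom

/-- Cocartesian arrows. -/
def IsCocart (φ : HomOver f A D) : Prop := p.IsStronglyCocartesian f φ.hom

namespace IsCart

lemma exists_lift {φ : HomOver f A D} (H : φ.IsCart) {h : Z ⟶ Y} (ψ : HomOver h G D)
    (g : Z ⟶ X) (e : h = g ≫ f) : ∃ χ : HomOver g G A, χ.hom ≫ φ.hom = ψ.hom := by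
  have : p.IsStronglyCartesian f φ.hom := H
  exact ⟨⟨IsStronglyCartesian.map p f φ.hom e ψ.hom, inferInstance⟩, by simp⟩

/-- The factorisation of an arrow through a cartesian arrow. -/
noncomputable def lift {φ : HomOver f A D} (H : φ.IsCart) {h : Z ⟶ Y} (ψ : HomOver h G D)
    (g : Z ⟶ X) (e : h = g ≫ f := by simp) : HomOver g G A := (H.exists_lift ψ g e).choose

@[simp]
lemma fac {φ : HomOver f A D} (H : φ.IsCart) {h : Z ⟶ Y} (ψ : HomOver h G D)
    (g : Z ⟶ X) (e : h = g ≫ f) : (H.lift ψ g e).hom ≫ φ.hom = ψ.hom :=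
  (H.exists_lift ψ g e).choose_spec

@[simp]
lemma fac_assoc {φ : HomOver f A D} (H : φ.IsCart) {h : Z ⟶ Y} (ψ : HomOver h G D)
    (g : Z ⟶ X) (e : h = g ≫ f) {c : E} (k : tot D ⟶ c) :
    (H.lift ψ g e).hom ≫ φ.hom ≫ k = ψ.hom ≫ k := by
  rw [← Category.assoc, H.fac]

lemma ext {φ : HomOver f A D} (H : φ.IsCart) {g g' : Z ⟶ X} (χ : HomOver g G A)
    (χ' : HomOver g' G A) (h : χ.hom ≫ φ.hom = χ'.hom ≫ φ.hom) (e : g = g' := by simp) :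
    χ.hom = χ'.hom := by
  subst e
  have : p.IsStronglyCartesian f φ.hom := H
  exact IsStronglyCartesian.ext p f φ.hom g h

lemma comp {g : Y ⟶ Z} {φ : HomOver f A D} (H : φ.IsCart) {ψ : HomOver g D G} (H' : ψ.IsCart) :
    (φ.comp ψ).IsCart := by
  have : p.IsStronglyCartesian f φ.hom := H
  have : p.IsStronglyCartesian g ψ.hom := H'
  exact IsStronglyCartesian.comp p

lemma of_comp {g : Y ⟶ Z} {φ : HomOver f A D} {ψ : HomOver g D G} (H : ψ.IsCart)
    (H' : (φ.comp ψ).IsCart) : φ.IsCart := by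
  have : p.IsStronglyCartesian g ψ.hom := H
  have : p.IsStronglyCartesian (f ≫ g) (φ.hom ≫ ψ.hom) := H'
  exact IsStronglyCartesian.of_comp p (g := g) (ψ := ψ.hom)

lemma congr {φ : HomOver f A D} (H : φ.IsCart) {ψ : HomOver f' A D} (h : φ.hom = ψ.hom)
    (e : f = f' := by simp) : ψ.IsCart := by
  subst e
  rwa [← HomOver.ext h]

lemma of_isIso (φ : HomOver f A D) [IsIso φ.hom] : φ.IsCart :=
  IsStronglyCartesian.of_isIso p f φ.hom

lemma isIso {φ : HomOver f A D} (H : φ.IsCart) [IsIso f] : IsIso φ.hom :=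
  have : p.IsStronglyCartesian f φ.hom := H
  IsStronglyCartesian.isIso_of_base_isIso p f φ.hom

lemma id (A : p.Fiber X) : (HomOver.id A).IsCart :=
  have : IsIso (HomOver.id A).hom := inferInstanceAs (IsIso (𝟙 _))
  of_isIso _

lemma of_section {ρ : HomOver f A D} (H : ρ.IsCart) {s : Y ⟶ X} {σ : HomOver s D A}
    (h : σ.hom ≫ ρ.hom = 𝟙 _) (e : s ≫ f = 𝟙 Y) : σ.IsCart :=
  of_comp H ((id D).congr h.symm e.symm)

end IsCart

namespace IsCocart

lemma exists_desc {φ : HomOver f A D} (H : φ.IsCocart) {h : X ⟶ Z} (ψ : HomOver h A G)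
    (g : Y ⟶ Z) (e : h = f ≫ g) : ∃ χ : HomOver g D G, φ.hom ≫ χ.hom = ψ.hom := by
  have : p.IsStronglyCocartesian f φ.hom := H
  exact ⟨⟨IsStronglyCocartesian.map p f φ.hom e ψ.hom, inferInstance⟩, by simp⟩

/-- The factorisation of an arrow through a cocartesian arrow. -/
noncomputable def desc {φ : HomOver f A D} (H : φ.IsCocart) {h : X ⟶ Z} (ψ : HomOver h A G)
    (g : Y ⟶ Z) (e : h = f ≫ g := by simp) : HomOver g D G := (H.exists_desc ψ g e).choose

@[simp]
lemma fac {φ : HomOver f A D} (H : φ.IsCocart) {h : X ⟶ Z} (ψ : HomOver h A G)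
    (g : Y ⟶ Z) (e : h = f ≫ g) : φ.hom ≫ (H.desc ψ g e).hom = ψ.hom :=
  (H.exists_desc ψ g e).choose_spec

lemma ext {φ : HomOver f A D} (H : φ.IsCocart) {g g' : Y ⟶ Z} (χ : HomOver g D G)
    (χ' : HomOver g' D G) (h : φ.hom ≫ χ.hom = φ.hom ≫ χ'.hom) (e : g = g' := by simp) :
    χ.hom = χ'.hom := by
  subst e
  have : p.IsStronglyCocartesian f φ.hom := H
  exact IsStronglyCocartesian.ext p f φ.hom g h

lemma comp {g : Y ⟶ Z} {φ : HomOver f A D} (H : φ.IsCocart) {ψ : HomOver g D G}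
    (H' : ψ.IsCocart) : (φ.comp ψ).IsCocart := by
  have : p.IsStronglyCocartesian f φ.hom := H
  have : p.IsStronglyCocartesian g ψ.hom := H'
  exact IsStronglyCocartesian.comp p

lemma congr {φ : HomOver f A D} (H : φ.IsCocart) {ψ : HomOver f' A D} (h : φ.hom = ψ.hom)
    (e : f = f' := by simp) : ψ.IsCocart := by
  subst e
  rwa [← HomOver.ext h]

lemma of_isIso (φ : HomOver f A D) [IsIso φ.hom] : φ.IsCocart :=
  IsStronglyCocartesian.of_isIso p f φ.hom

lemma isIso {φ : HomOver f A D} (H : φ.IsCocart) [IsIso f] : IsIso φ.hom :=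
  have : p.IsStronglyCocartesian f φ.hom := H
  IsStronglyCocartesian.isIso_of_base_isIso p f φ.hom

lemma of_comp {g : Y ⟶ Z} {φ : HomOver f A D} {ψ : HomOver g D G} (H : φ.IsCocart)
    (H' : (φ.comp ψ).IsCocart) : ψ.IsCocart := by
  have : p.IsStronglyCocartesian f φ.hom := H
  have : p.IsStronglyCocartesian (f ≫ g) (φ.hom ≫ ψ.hom) := H'
  exact IsStronglyCocartesian.of_comp p (f := f) (φ := φ.hom)

end IsCocart

end HomOver

end HomOver

section JointlyCartesian

/-- The pair `k₁ : K ⟶ A` over `f`, `k₂ : K ⟶ D` over `g` exhibits `K` as `f^* A ∧ g^* D`, with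
the universal property relative to all arrows of the base. -/
structure IsJointlyCart {Γ X Y : B} {f : Γ ⟶ X} {g : Γ ⟶ Y} {K : p.Fiber Γ} {A : p.Fiber X}
    {D : p.Fiber Y} (k₁ : HomOver f K A) (k₂ : HomOver g K D) : Prop where
  exists_lift : ∀ {W : B} {C : p.Fiber W} (h : W ⟶ Γ) (φ₁ : HomOver (h ≫ f) C A)
    (φ₂ : HomOver (h ≫ g) C D),
    ∃ φ : HomOver h C K, φ.hom ≫ k₁.hom = φ₁.hom ∧ φ.hom ≫ k₂.hom = φ₂.hom
  uniq : ∀ {W : B} {C : p.Fiber W} (h : W ⟶ Γ) (φ φ' : HomOver h C K),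
    φ.hom ≫ k₁.hom = φ'.hom ≫ k₁.hom → φ.hom ≫ k₂.hom = φ'.hom ≫ k₂.hom → φ.hom = φ'.hom

namespace IsJointlyCart

variable {Γ X Y W : B} {f : Γ ⟶ X} {g : Γ ⟶ Y} {K : p.Fiber Γ} {A : p.Fiber X} {D : p.Fiber Y}
  {k₁ : HomOver f K A} {k₂ : HomOver g K D} {C : p.Fiber W}

section Lift

variable (H : IsJointlyCart k₁ k₂) (h : W ⟶ Γ) {f₁ : W ⟶ X} {f₂ : W ⟶ Y} (φ₁ : HomOver f₁ C A)
  (φ₂ : HomOver f₂ C D)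

/-- The arrow into the vertex of a jointly cartesian pair induced by its components. -/
noncomputable def lift (e₁ : f₁ = h ≫ f := by simp) (e₂ : f₂ = h ≫ g := by simp) :
    HomOver h C K :=
  (H.exists_lift h (φ₁.cast e₁) (φ₂.cast e₂)).choose

variable (e₁ : f₁ = h ≫ f) (e₂ : f₂ = h ≫ g)

@[simp]
lemma lift_fst : (H.lift h φ₁ φ₂ e₁ e₂).hom ≫ k₁.hom = φ₁.hom :=
  (H.exists_lift h (φ₁.cast e₁) (φ₂.cast e₂)).choose_spec.1

@[simp]
lemma lift_fst_assoc {c : E} (k : tot A ⟶ c) :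
    (H.lift h φ₁ φ₂ e₁ e₂).hom ≫ k₁.hom ≫ k = φ₁.hom ≫ k := by
  rw [← Category.assoc, lift_fst]

@[simp]
lemma lift_snd : (H.lift h φ₁ φ₂ e₁ e₂).hom ≫ k₂.hom = φ₂.hom :=
  (H.exists_lift h (φ₁.cast e₁) (φ₂.cast e₂)).choose_spec.2

@[simp]
lemma lift_snd_assoc {c : E} (k : tot D ⟶ c) :
    (H.lift h φ₁ φ₂ e₁ e₂).hom ≫ k₂.hom ≫ k = φ₂.hom ≫ k := by
  rw [← Category.assoc, lift_snd]

end Lift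

lemma ext (H : IsJointlyCart k₁ k₂) {h h' : W ⟶ Γ} (φ : HomOver h C K) (φ' : HomOver h' C K)
    (h₁ : φ.hom ≫ k₁.hom = φ'.hom ≫ k₁.hom) (h₂ : φ.hom ≫ k₂.hom = φ'.hom ≫ k₂.hom)
    (e : h = h' := by simp) : φ.hom = φ'.hom := by
  subst e
  exact H.uniq h _ _ h₁ h₂

lemma comp_cart (H : IsJointlyCart k₁ k₂) {X' Y' : B} {f' : X ⟶ X'} {g' : Y ⟶ Y'}
    {A' : p.Fiber X'} {D' : p.Fiber Y'} {ρ : HomOver f' A A'} {β : HomOver g' D D'}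
    (hρ : ρ.IsCart) (hβ : β.IsCart) {l : Γ ⟶ X'} {m : Γ ⟶ Y'} {k₁' : HomOver l K A'}
    {k₂' : HomOver m K D'} (h₁ : k₁'.hom = k₁.hom ≫ ρ.hom) (h₂ : k₂'.hom = k₂.hom ≫ β.hom)
    (el : l = f ≫ f' := by simp) (em : m = g ≫ g' := by simp) : IsJointlyCart k₁' k₂' where
  exists_lift h φ₁ φ₂ :=
    ⟨H.lift h (hρ.lift φ₁ (h ≫ f) (by simp [el])) (hβ.lift φ₂ (h ≫ g) (by simp [em])) rfl rfl,
      by simp [h₁], by simp [h₂]⟩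
  uniq h φ φ' e₁ e₂ :=
    H.ext φ φ' (hρ.ext (φ.comp k₁) (φ'.comp k₁) (by simpa [h₁] using e₁))
      (hβ.ext (φ.comp k₂) (φ'.comp k₂) (by simpa [h₂] using e₂))

lemma pullback (H : IsJointlyCart k₁ k₂) {Γ' X' : B} {u : Γ' ⟶ Γ} {v : X' ⟶ X} {K' : p.Fiber Γ'}
    {A' : p.Fiber X'} {β : HomOver u K' K} {α : HomOver v A' A} (hβ : β.IsCart) (hα : α.IsCart)
    {f' : Γ' ⟶ X'} {g' : Γ' ⟶ Y} {k₁' : HomOver f' K' A'} {k₂' : HomOver g' K' D}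
    (ef : f' ≫ v = u ≫ f) (eg : g' = u ≫ g) (h₁ : k₁'.hom ≫ α.hom = β.hom ≫ k₁.hom)
    (h₂ : k₂'.hom = β.hom ≫ k₂.hom) : IsJointlyCart k₁' k₂' where
  exists_lift h φ₁ φ₂ := by
    let φ := hβ.lift (H.lift (h ≫ u) (φ₁.comp α) φ₂ (by simp [ef]) (by simp [eg])) h rfl
    exact ⟨φ, hα.ext (φ.comp k₁') φ₁ (by simp [h₁, φ]), by simp [h₂, φ]⟩
  uniq h φ φ' e₁ e₂ := by
    refine hβ.ext φ φ' (H.ext (φ.comp β) (φ'.comp β) ?_ ?_)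
    · simpa [h₁] using congrArg (· ≫ α.hom) e₁
    · simpa [h₂] using e₂

lemma isBinProd (H : IsJointlyCart k₁ k₂) {A' D' : p.Fiber Γ} {ρ : HomOver f A' A}
    {β : HomOver g D' D} (hρ : ρ.IsCart) (hβ : β.IsCart) {π₁ : K ⟶ A'} {π₂ : K ⟶ D'}
    (h₁ : und π₁ ≫ ρ.hom = k₁.hom) (h₂ : und π₂ ≫ β.hom = k₂.hom) : IsBinProd π₁ π₂ := by
  refine IsBinProd.of_exists_lift (fun a b => ?_) (fun φ φ' e₁ e₂ => ?_)
  · let φ := H.lift (𝟙 Γ) ((HomOver.ofFiber a).comp ρ) ((HomOver.ofFiber b).comp β)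
    refine ⟨φ.toFiber, und_ext ?_, und_ext ?_⟩
    · exact hρ.ext (.ofFiber (φ.toFiber ≫ π₁)) (.ofFiber a) (by simp [h₁, φ])
    · exact hβ.ext (.ofFiber (φ.toFiber ≫ π₂)) (.ofFiber b) (by simp [h₂, φ])
  · refine und_ext (H.ext (.ofFiber φ) (.ofFiber φ') ?_ ?_)
    · simpa [h₁] using congrArg (fun x => und x ≫ ρ.hom) e₁
    · simpa [h₂] using congrArg (fun x => und x ≫ β.hom) e₂

end IsJointlyCart

end JointlyCartesian

section Fibration

lemma und_comp {X : B} {A A' A'' : p.Fiber X} (φ : A ⟶ A') (ψ : A' ⟶ A'') :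
    und (φ ≫ ψ) = und φ ≫ und ψ :=
  Functor.map_comp _ _ _

variable [p.IsFibered]

/-- The chosen cartesian lift `f^* D ⟶ D` of `f`. -/
noncomputable def reindexHom {X Y : B} (f : X ⟶ Y) (D : p.Fiber Y) :
    HomOver f ((reindex p f).obj D) D :=
  ⟨cart p f D, inferInstance⟩

lemma isCart_reindexHom {X Y : B} (f : X ⟶ Y) (D : p.Fiber Y) : (reindexHom f D).IsCart :=
  cart_isStronglyCartesian p f D

lemma reindexHom_comp_und {X Y : B} (f : X ⟶ Y) {A A' : p.Fiber Y} (φ : A ⟶ A') :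
    (reindexHom f A).hom ≫ und φ = und ((reindex p f).map φ) ≫ (reindexHom f A').hom :=
  cart_und p f φ

lemma HomOver.IsCocart.of_vertical {X Y : B} {f : X ⟶ Y} {A : p.Fiber X} {D : p.Fiber Y}
    (φ : HomOver f A D)
    (ex : ∀ (G : p.Fiber Y) (ψ : HomOver f A G), ∃ χ : HomOver (𝟙 Y) D G, φ.hom ≫ χ.hom = ψ.hom)
    (uniq : ∀ (G : p.Fiber Y) (χ χ' : HomOver (𝟙 Y) D G), φ.hom ≫ χ.hom = φ.hom ≫ χ'.hom →
      χ.hom = χ'.hom) : φ.IsCocart where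
  universal_property' {b} g ψ hψ := by
    let G : p.Fiber (p.obj b) := Fiber.mk rfl
    have hG : (reindexHom g G).IsCart := isCart_reindexHom g G
    let ψ' := hG.lift (⟨ψ, hψ⟩ : HomOver (f ≫ g) A G) f rfl
    obtain ⟨χ, hχ⟩ := ex _ ψ'
    have hχ' : φ.hom ≫ χ.hom ≫ (reindexHom g G).hom = ψ := by
      rw [reassoc_of% hχ]
      exact hG.fac _ _ _
    refine ⟨(χ.comp (reindexHom g G)).hom,
      ⟨((χ.comp (reindexHom g G)).cast : HomOver g D G).isHomLift, hχ'⟩, ?_⟩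
    rintro τ ⟨hτ, hτ'⟩
    let τ' := hG.lift (⟨τ, hτ⟩ : HomOver g D G) (𝟙 Y)
    have hf : τ'.hom ≫ (reindexHom g G).hom = τ := hG.fac _ _ _
    have : τ'.hom = χ.hom := by
      refine uniq _ _ _ (hG.ext (φ.comp τ') (φ.comp χ) ?_)
      simp only [HomOver.comp_hom, Category.assoc, hf, hχ']
      exact hτ'
    rw [HomOver.comp_hom, ← this, hf]

end Fibration

section FibredProducts

variable [p.IsFibered] [HasFibredProducts p]

/-- The arrow over `f` into the terminal object of a fibre. -/
noncomputable def toTopOver {X Y : B} (f : X ⟶ Y) (A : p.Fiber X) : HomOver f A (⊤_ (p.Fiber Y)) :=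
  ⟨toTop p f A, inferInstance⟩

lemma top_ext {X Y : B} {f g : X ⟶ Y} {A : p.Fiber X} (φ : HomOver f A (⊤_ (p.Fiber Y)))
    (ψ : HomOver g A (⊤_ (p.Fiber Y))) (e : f = g := by simp) : φ.hom = ψ.hom := by
  subst e
  have h : cartVert p f (⊤_ _) φ.hom = cartVert p f (⊤_ _) ψ.hom :=
    (terminalIsTerminal.isTerminalObj (reindex p f) _).hom_ext _ _
  rw [← und_cartVert_cart p f _ φ.hom, h, und_cartVert_cart]

@[simp]
lemma comp_toTopOver {X Y Z : B} {f : X ⟶ Y} {g : Y ⟶ Z} {A : p.Fiber X} {D : p.Fiber Y}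
    (φ : HomOver f A D) : φ.hom ≫ (toTopOver g D).hom = (toTopOver (f ≫ g) A).hom :=
  top_ext (φ.comp (toTopOver g D)) _

@[simp]
lemma comp_toTopOver_assoc {X Y Z : B} {f : X ⟶ Y} {g : Y ⟶ Z} {A : p.Fiber X} {D : p.Fiber Y}
    (φ : HomOver f A D) {c : E} (k : tot (⊤_ (p.Fiber Z)) ⟶ c) :
    φ.hom ≫ (toTopOver g D).hom ≫ k = (toTopOver (f ≫ g) A).hom ≫ k := by
  rw [← Category.assoc, comp_toTopOver]

@[simp]
lemma toTopOver_id_top {X : B} : (toTopOver (𝟙 X) (⊤_ (p.Fiber X))).hom = 𝟙 _ :=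
  top_ext _ (HomOver.id _)

lemma isCart_top {X Y : B} {f : X ⟶ Y} (φ : HomOver f (⊤_ (p.Fiber X)) (⊤_ (p.Fiber Y))) :
    φ.IsCart := by
  let i := HomOver.ofFiber (PreservesTerminal.iso (reindex p f)).inv
  have : IsIso i.hom := inferInstanceAs (IsIso (Fiber.fiberInclusion.map _))
  exact ((HomOver.IsCart.of_isIso i).comp (isCart_reindexHom f _)).congr (top_ext _ _)

lemma IsBinProd.map_reindex {W Γ : B} (h : W ⟶ Γ) {P A D : p.Fiber Γ} {π₁ : P ⟶ A} {π₂ : P ⟶ D}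
    (H : IsBinProd π₁ π₂) : IsBinProd ((reindex p h).map π₁) ((reindex p h).map π₂) :=
  ⟨mapIsLimitOfPreservesOfIsLimit (reindex p h) _ _ H.some⟩

/-- Since reindexing preserves them, products in the fibres have the universal property relative
to all arrows of the base. -/
lemma IsBinProd.isJointlyCart {Γ : B} {P A D : p.Fiber Γ} {π₁ : P ⟶ A} {π₂ : P ⟶ D}
    (H : IsBinProd π₁ π₂) : IsJointlyCart (HomOver.ofFiber π₁) (HomOver.ofFiber π₂) where
  exists_lift {W C} h φ₁ φ₂ := by
    have hφ₁ : p.IsHomLift h φ₁.hom := φ₁.cast.isHomLift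
    have hφ₂ : p.IsHomLift h φ₂.hom := φ₂.cast.isHomLift
    let φ := (H.map_reindex h).lift (cartVert p h A φ₁.hom) (cartVert p h D φ₂.hom)
    refine ⟨((HomOver.ofFiber φ).comp (reindexHom h P)).cast, ?_, ?_⟩
    · simp only [HomOver.cast_hom, HomOver.comp_hom, HomOver.ofFiber_hom, Category.assoc,
        reindexHom_comp_und, φ]
      rw [← Functor.map_comp_assoc, IsBinProd.lift_fst]
      exact und_cartVert_cart p h A φ₁.hom
    · simp only [HomOver.cast_hom, HomOver.comp_hom, HomOver.ofFiber_hom, Category.assoc,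
        reindexHom_comp_und, φ]
      rw [← Functor.map_comp_assoc, IsBinProd.lift_snd]
      exact und_cartVert_cart p h D φ₂.hom
  uniq {W C} h φ φ' e₁ e₂ := by
    have nat {A' : p.Fiber Γ} (π : P ⟶ A') (χ : HomOver h C P) :
        und (cartVert p h P χ.hom ≫ (reindex p h).map π) ≫ (reindexHom h A').hom =
          χ.hom ≫ und π := by
      rw [und_comp, Category.assoc, ← reindexHom_comp_und, ← Category.assoc]
      exact congrArg (· ≫ und π) (und_cartVert_cart p h P χ.hom)
    have vertical : cartVert p h P φ.hom = cartVert p h P φ'.hom := by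
      refine (H.map_reindex h).hom_ext (und_ext ?_) (und_ext ?_)
      · exact (isCart_reindexHom h A).ext (.ofFiber (cartVert p h P φ.hom ≫ (reindex p h).map π₁))
          (.ofFiber (cartVert p h P φ'.hom ≫ (reindex p h).map π₁))
          ((nat π₁ φ).trans (e₁.trans (nat π₁ φ').symm))
      · exact (isCart_reindexHom h D).ext (.ofFiber (cartVert p h P φ.hom ≫ (reindex p h).map π₂))
          (.ofFiber (cartVert p h P φ'.hom ≫ (reindex p h).map π₂))
          ((nat π₂ φ).trans (e₂.trans (nat π₂ φ').symm))
    rw [← und_cartVert_cart p h P φ.hom, vertical, und_cartVert_cart]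

section JointObj

variable {Γ X Y : B} (f : Γ ⟶ X) (g : Γ ⟶ Y) (A : p.Fiber X) (D : p.Fiber Y)

/-- The object `f^* A ∧ g^* D`. -/
noncomputable def jointObj : p.Fiber Γ := (reindex p f).obj A ⨯ (reindex p g).obj D

/-- The arrow `f^* A ∧ g^* D ⟶ A` over `f`. -/
noncomputable def jointFst : HomOver f (jointObj f g A D) A :=
  ((HomOver.ofFiber prod.fst).comp (reindexHom f A)).cast

/-- The arrow `f^* A ∧ g^* D ⟶ D` over `g`. -/
noncomputable def jointSnd : HomOver g (jointObj f g A D) D :=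
  ((HomOver.ofFiber prod.snd).comp (reindexHom g D)).cast

lemma isJointlyCart_joint : IsJointlyCart (jointFst f g A D) (jointSnd f g A D) :=
  (IsBinProd.of_prod _ _).isJointlyCart.comp_cart (isCart_reindexHom f A) (isCart_reindexHom g D)
    rfl rfl

end JointObj

lemma IsJointlyCart.isCart_fst {Γ X Y : B} {f : Γ ⟶ X} {g : Γ ⟶ Y} {K : p.Fiber Γ}
    {A : p.Fiber X} {k₁ : HomOver f K A} {k₂ : HomOver g K (⊤_ (p.Fiber Y))}
    (H : IsJointlyCart k₁ k₂) : k₁.IsCart where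
  universal_property' {c} h φ hφ := by
    let C : p.Fiber (p.obj c) := Fiber.mk rfl
    let φ' := H.lift h (⟨φ, hφ⟩ : HomOver (h ≫ f) C A) (toTopOver (h ≫ g) C)
    have hφ' : φ'.hom ≫ k₁.hom = φ := H.lift_fst _ _ _ _ _
    refine ⟨φ'.hom, ⟨φ'.isHomLift, hφ'⟩, ?_⟩
    rintro τ ⟨hτ, hτ'⟩
    let τ' : HomOver h C K := ⟨τ, hτ⟩
    exact H.ext τ' φ' (hτ'.trans hφ'.symm) (top_ext (τ'.comp k₂) (φ'.comp k₂))

lemma IsBinProd.isIso_fst {Γ X : B} {P A D : p.Fiber Γ} {π₁ : P ⟶ A} {π₂ : P ⟶ D}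
    (H : IsBinProd π₁ π₂) {f : Γ ⟶ X} {α : HomOver f D (⊤_ (p.Fiber X))} (hα : α.IsCart) :
    IsIso (HomOver.ofFiber π₁).hom :=
  (H.isJointlyCart.comp_cart (.id A) hα (k₁' := .ofFiber π₁)
    (k₂' := (HomOver.ofFiber π₂).comp α) (by simp) rfl).isCart_fst.isIso

end FibredProducts

section Universal

variable [HasFiniteProducts B] [p.IsFibered] [HasFibredProducts p]

section Definitions

variable {X W : B} {w : W ⟶ X} {Q : p.Fiber (X ⨯ X)}

/-- The pair `(k₁, k₂)` exhibits the vertex of `j : A ⟶ K` as `A ∧ Q`, reindexed to `W × X`, and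
`j` is the arrow `⟨1, r !⟩` over `⟨1, w⟩ : W ⟶ W × X`, the reflexivity of `Q` on `A`. -/
structure IsReflArrow (r : HomOver (w ≫ dia X) (⊤_ (p.Fiber W)) Q) {Z : B} {e : Z ⟶ W} {z : Z ⟶ X}
    {d : W ⟶ Z} {A : p.Fiber W} {K : p.Fiber Z} (k₁ : HomOver e K A)
    (k₂ : HomOver (prod.lift (e ≫ w) z) K Q) (j : HomOver d A K) : Prop where
  isBinProd : IsBinProd e z
  comp_fst : d ≫ e = 𝟙 W
  comp_snd : d ≫ z = w
  isJointlyCart : IsJointlyCart k₁ k₂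
  hom_fst : j.hom ≫ k₁.hom = 𝟙 _
  hom_snd : j.hom ≫ k₂.hom = (toTopOver (𝟙 W) A).hom ≫ r.hom

/-- The point `r` of `Q` over the diagonal has the universal property of an equality predicate
along `w : W ⟶ X`. -/
def IsUniversal (r : HomOver (w ≫ dia X) (⊤_ (p.Fiber W)) Q) : Prop :=
  ∀ ⦃Z : B⦄ ⦃e : Z ⟶ W⦄ ⦃z : Z ⟶ X⦄ ⦃d : W ⟶ Z⦄ ⦃A : p.Fiber W⦄ ⦃K : p.Fiber Z⦄
    ⦃k₁ : HomOver e K A⦄ ⦃k₂ : HomOver (prod.lift (e ≫ w) z) K Q⦄ ⦃j : HomOver d A K⦄,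
    IsReflArrow r k₁ k₂ j → j.IsCocart

end Definitions

section Act

variable {X W : B} (w : W ⟶ X) (Q : p.Fiber (X ⨯ X)) (A : p.Fiber W)

/-- The object `A ∧ Q` over `W × X` of pairs of an element of `A` and an equality in `Q` starting
at its image under `w`. -/
noncomputable abbrev act : p.Fiber (W ⨯ X) :=
  jointObj prod.fst (prod.lift (prod.fst ≫ w) prod.snd) A Q

/-- The first projection of `A ∧ Q`. -/
noncomputable abbrev actFst : HomOver prod.fst (act w Q A) A := jointFst _ _ A Q

/-- The second projection of `A ∧ Q`. -/
noncomputable abbrev actSnd : HomOver (prod.lift (prod.fst ≫ w) prod.snd) (act w Q A) Q :=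
  jointSnd _ _ A Q

lemma isJointlyCart_act : IsJointlyCart (actFst w Q A) (actSnd w Q A) :=
  isJointlyCart_joint _ _ A Q

variable {w Q}

/-- The arrow `⟨1, r !⟩ : A ⟶ A ∧ Q`. -/
noncomputable def actPt (r : HomOver (w ≫ dia X) (⊤_ (p.Fiber W)) Q) :
    HomOver (prod.lift (𝟙 W) w) A (act w Q A) :=
  (isJointlyCart_act w Q A).lift _ (HomOver.id A) ((toTopOver (𝟙 W) A).comp r)

variable {A}

lemma isReflArrow_actPt (r : HomOver (w ≫ dia X) (⊤_ (p.Fiber W)) Q) :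
    IsReflArrow r (actFst w Q A) (actSnd w Q A) (actPt A r) where
  isBinProd := .of_prod W X
  comp_fst := by simp
  comp_snd := by simp
  isJointlyCart := isJointlyCart_act w Q A
  hom_fst := (isJointlyCart_act w Q A).lift_fst _ _ _ _ _
  hom_snd := (isJointlyCart_act w Q A).lift_snd _ _ _ _ _

end Act

namespace IsReflArrow

variable {X W : B} {w : W ⟶ X} {Q : p.Fiber (X ⨯ X)} {r : HomOver (w ≫ dia X) (⊤_ (p.Fiber W)) Q}
  {Z Z' : B} {e : Z ⟶ W} {z : Z ⟶ X} {d : W ⟶ Z} {A : p.Fiber W} {K : p.Fiber Z}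
  {k₁ : HomOver e K A} {k₂ : HomOver (prod.lift (e ≫ w) z) K Q} {j : HomOver d A K}
  {e' : Z' ⟶ W} {z' : Z' ⟶ X} {d' : W ⟶ Z'} {K' : p.Fiber Z'}
  {k₁' : HomOver e' K' A} {k₂' : HomOver (prod.lift (e' ≫ w) z') K' Q} {j' : HomOver d' A K'}

lemma isCocart_of_isCocart (h : IsReflArrow r k₁ k₂ j) (hj : j.IsCocart)
    (h' : IsReflArrow r k₁' k₂' j') : j'.IsCocart := by
  let ζ := h.isBinProd.lift e' z'
  let ζ' := h'.isBinProd.lift e z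
  let κ : HomOver ζ K' K := h.isJointlyCart.lift ζ k₁' k₂' (by simp [ζ]) (by simp [ζ])
  let κ' : HomOver ζ' K K' := h'.isJointlyCart.lift ζ' k₁ k₂ (by simp [ζ']) (by simp [ζ'])
  have hκκ' : κ.hom ≫ κ'.hom = 𝟙 _ :=
    h'.isJointlyCart.ext (κ.comp κ') (.id K') (by simp [κ, κ']) (by simp [κ, κ'])
      (h'.isBinProd.hom_ext (by simp [ζ, ζ']) (by simp [ζ, ζ']))
  have hκ'κ : κ'.hom ≫ κ.hom = 𝟙 _ :=
    h.isJointlyCart.ext (κ'.comp κ) (.id K) (by simp [κ, κ']) (by simp [κ, κ'])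
      (h.isBinProd.hom_ext (by simp [ζ, ζ']) (by simp [ζ, ζ']))
  have : IsIso κ'.hom := ⟨κ.hom, hκ'κ, hκκ'⟩
  have hd : d ≫ ζ' = d' :=
    h'.isBinProd.hom_ext (by simp [ζ', h.comp_fst, h'.comp_fst])
      (by simp [ζ', h.comp_snd, h'.comp_snd])
  refine (hj.comp (.of_isIso κ')).congr (h'.isJointlyCart.ext (j.comp κ') j' ?_ ?_ hd) hd
  · simp [κ', h.hom_fst, h'.hom_fst]
  · simp [κ', h.hom_snd, h'.hom_snd]

end IsReflArrow

namespace IsUniversal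

variable {X W : B} {w : W ⟶ X} {Q : p.Fiber (X ⨯ X)} {r : HomOver (w ≫ dia X) (⊤_ (p.Fiber W)) Q}

lemma of_isReflArrow {Z : B} {e : Z ⟶ W} {z : Z ⟶ X} {d : W ⟶ Z}
    (H : ∀ A : p.Fiber W, ∃ (K : p.Fiber Z) (k₁ : HomOver e K A)
      (k₂ : HomOver (prod.lift (e ≫ w) z) K Q) (j : HomOver d A K),
      IsReflArrow r k₁ k₂ j ∧ j.IsCocart) : IsUniversal r := by
  intro Z' e' z' d' A K' k₁' k₂' j' h'
  obtain ⟨K, k₁, k₂, j, h, hj⟩ := H A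
  exact h.isCocart_of_isCocart hj h'

lemma isCocart_actPt (H : IsUniversal r) (A : p.Fiber W) : (actPt A r).IsCocart :=
  H (isReflArrow_actPt r)

lemma of_isCocart_actPt (H : ∀ A : p.Fiber W, (actPt A r).IsCocart) : IsUniversal r :=
  of_isReflArrow fun A => ⟨_, _, _, _, isReflArrow_actPt r, H A⟩

lemma of_iso (H : IsUniversal r) {W' : B} (i : W' ≅ W) {w' : W' ⟶ X} (hw' : w' = i.hom ≫ w)
    {r' : HomOver (w' ≫ dia X) (⊤_ (p.Fiber W')) Q}
    (hr : r'.hom = (toTopOver i.hom _).hom ≫ r.hom) : IsUniversal r' := by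
  subst hw'
  intro Z e z d A K k₁ k₂ j hj
  let a := reindexHom i.inv A
  have : IsIso a.hom := (isCart_reindexHom i.inv A).isIso
  let a' : HomOver i.hom A _ := a.inv.cast
  have : IsIso a'.hom := inferInstanceAs (IsIso (inv a.hom))
  have hb : prod.lift (e ≫ i.hom ≫ w) z = prod.lift ((e ≫ i.hom) ≫ w) z := by simp
  have refl : IsReflArrow r (k₁.comp a') (k₂.cast hb) (a.comp j) :=
    { isBinProd := hj.isBinProd.comp_iso i
      comp_fst := by simp [reassoc_of% hj.comp_fst]
      comp_snd := by simp [hj.comp_snd]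
      isJointlyCart := hj.isJointlyCart.comp_cart (.of_isIso a') (.id Q) rfl (by simp)
      hom_fst := by simp [reassoc_of% hj.hom_fst, a']
      hom_snd := by
        rw [HomOver.comp_hom, HomOver.cast_hom, Category.assoc, hj.hom_snd, hr,
          comp_toTopOver_assoc, comp_toTopOver_assoc]
        exact congrArg (· ≫ r.hom) (top_ext _ _) }
  exact ((HomOver.IsCocart.of_isIso a').comp (H refl)).congr (by simp [a'])

end IsUniversal

end Universal

section CocartOver

variable {Θ : MorphismProperty B}

lemma HomOver.cocartOver_iff {X Y : B} {f : X ⟶ Y} {A : p.Fiber X} {D : p.Fiber Y}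
    (φ : HomOver f A D) : cocartOver p Θ φ.hom ↔ φ.IsCocart ∧ Θ f := by
  suffices ∀ {a b : E} (ψ : a ⟶ b) [p.IsHomLift f ψ],
      cocartOver p Θ ψ ↔ p.IsStronglyCocartesian f ψ ∧ Θ f from this φ.hom
  intro a b ψ _
  subst_hom_lift p f ψ
  rfl

lemma cocartOver.fibEpic {a b : E} {φ : a ⟶ b} (h : cocartOver p Θ φ) : fibEpic p φ := by
  intro b' ψ ψ' e e'
  have := h.1
  have : p.IsHomLift (p.map ψ) ψ' := e ▸ inferInstance
  exact IsStronglyCocartesian.ext p (p.map φ) φ (p.map ψ) e'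

lemma HomOver.ext_of_fibEpic {X Y Z : B} {f : X ⟶ Y} {g : Y ⟶ Z} {A : p.Fiber X} {D : p.Fiber Y}
    {G : p.Fiber Z} {φ : HomOver f A D} (H : fibEpic p φ.hom) (χ χ' : HomOver g D G)
    (h : φ.hom ≫ χ.hom = φ.hom ≫ χ'.hom) : χ.hom = χ'.hom := by
  suffices ∀ {a b c : E} {φ : a ⟶ b} (χ χ' : b ⟶ c) [p.IsHomLift g χ] [p.IsHomLift g χ'],
      fibEpic p φ → φ ≫ χ = φ ≫ χ' → χ = χ' from this χ.hom χ'.hom H h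
  intro a b c φ χ χ' _ _ H h
  refine H χ χ' ?_ h
  have : p.IsHomLift (p.map χ) χ' := by
    subst_hom_lift p g χ
    infer_instance
  exact IsHomLift.eq_of_isHomLift p (p.map χ) χ'

end CocartOver

section ParamDiag

variable [HasFiniteProducts B]

lemma paramDiag_pdia (Y X : B) : ParamDiag (pdia Y X) :=
  ⟨Y, X, prod.fst, prod.snd, prod.fst, prod.snd, .of_prod Y X, .of_prod _ X, prod.lift_fst _ _,
    prod.lift_snd _ _⟩

lemma paramDiag_dia (X : B) : ParamDiag (dia X) :=
  ⟨⊤_ B, X, terminal.from X, 𝟙 X, prod.fst, prod.snd, .of_terminal X, .of_prod X X,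
    prod.lift_fst _ _, prod.lift_snd _ _⟩

end ParamDiag

section Loops

variable [HasFiniteProducts B] [p.IsFibered] [HasFibredProducts p] {X : B}

namespace Loop

/-- The arrow `⊤_X ⟶ Eq_X` of a loop, bundled with the diagonal. -/
def arrOver (l : Loop p X) : HomOver (dia X) (⊤_ (p.Fiber X)) l.obj := ⟨l.arr, inferInstance⟩

@[simp]
lemma arrOver_hom (l : Loop p X) : l.arrOver.hom = l.arr := rfl

/-- The point `⊤_W ⟶ ⊤_X ⟶ Eq_X` of a loop over `⟨w, w⟩`. -/
noncomputable def refl (l : Loop p X) {W : B} (w : W ⟶ X) :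
    HomOver (w ≫ dia X) (⊤_ (p.Fiber W)) l.obj :=
  (toTopOver w (⊤_ (p.Fiber W))).comp l.arrOver

lemma toTopOver_comp_refl (l : Loop p X) {V W : B} (f : V ⟶ W) (w : W ⟶ X) (A : p.Fiber V) :
    (toTopOver f A).hom ≫ (l.refl w).hom = (toTopOver (f ≫ w) A).hom ≫ l.arr := by
  rw [refl, HomOver.comp_hom, comp_toTopOver_assoc]
  rfl

/-- The loop makes `Eq_X` an equality predicate on `X` relative to all parameters. -/
def IsUniversal (l : Loop p X) : Prop :=
  ∀ ⦃U W : B⦄ ⦃w₁ : W ⟶ U⦄ ⦃w : W ⟶ X⦄, IsBinProd w₁ w → ElemFib.IsUniversal (l.refl w)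

lemma IsUniversal.of_prod {l : Loop p X}
    (H : ∀ U : B, ElemFib.IsUniversal (l.refl (prod.snd : U ⨯ X ⟶ X))) : l.IsUniversal := by
  intro U W w₁ w hw
  let i : W ≅ U ⨯ X :=
    { hom := prod.lift w₁ w
      inv := hw.lift prod.fst prod.snd
      hom_inv_id := hw.hom_ext (by simp) (by simp) }
  refine (H U).of_iso i (by simp [i]) ?_
  rw [toTopOver_comp_refl, refl, HomOver.comp_hom]
  exact congrArg (· ≫ l.arr) (top_ext _ _ (by simp [i]))

/-- The reflexivity arrows `A ⟶ A ∧ Eq_X` of a loop, over all parametrised diagonals. -/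
inductive ReflClass (l : Loop p X) : ∀ {a b : E}, (a ⟶ b) → Prop
  | mk {U W Z : B} {w₁ : W ⟶ U} {w : W ⟶ X} {e : Z ⟶ W} {z : Z ⟶ X} {d : W ⟶ Z} {A : p.Fiber W}
      {K : p.Fiber Z} {k₁ : HomOver e K A} {k₂ : HomOver (prod.lift (e ≫ w) z) K l.obj}
      {j : HomOver d A K} (hw : IsBinProd w₁ w) (hj : IsReflArrow (l.refl w) k₁ k₂ j) :
      l.ReflClass j.hom

lemma isUniversal_iff_reflClass {l : Loop p X} :
    l.IsUniversal ↔ ∀ {a b : E} (ψ : a ⟶ b), l.ReflClass ψ → cocartOver p ParamDiag ψ := by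
  refine ⟨?_, fun H U W w₁ w hw Z e z d A K k₁ k₂ j hj => ?_⟩
  · rintro H _ _ _ ⟨hw, hj⟩
    exact (HomOver.cocartOver_iff _).2
      ⟨H hw hj, _, _, _, _, _, _, hw, hj.isBinProd, hj.comp_fst, hj.comp_snd⟩
  · exact ((HomOver.cocartOver_iff _).1 (H _ (.mk hw hj))).1

lemma ReflClass.bcfrClass {l : Loop p X} {a b : E} {ψ : a ⟶ b} (h : l.ReflClass ψ) :
    l.BCFRClass ψ := by
  obtain @⟨U, W, Z, w₁, w, e, z, d, A, K, k₁, k₂, j, hw, hj⟩ := h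
  let f := prod.lift (e ≫ w) z
  have hd : d ≫ f = w ≫ dia X := by simp [f, hj.comp_snd, reassoc_of% hj.comp_fst]
  let ρ := reindexHom e A
  have hρ : ρ.IsCart := isCart_reindexHom e A
  let σ : HomOver d A _ := hρ.lift (.id A) d hj.comp_fst.symm
  have hσρ : σ.hom ≫ ρ.hom = 𝟙 _ := hρ.fac _ _ _
  let β := reindexHom f l.obj
  have hβ : β.IsCart := isCart_reindexHom f l.obj
  let φ' : HomOver d _ _ := hβ.lift (l.refl w) d hd.symm
  have hφ' : φ'.hom ≫ β.hom = (l.refl w).hom := hβ.fac _ _ _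
  let π₁' := (hρ.lift k₁ (𝟙 Z)).toFiber
  let π₂' := (hβ.lift k₂ (𝟙 Z) (by simp [f])).toFiber
  have h₁ : und π₁' ≫ ρ.hom = k₁.hom := hρ.fac _ _ _
  have h₂ : und π₂' ≫ β.hom = k₂.hom := hβ.fac _ _ _
  refine BCFR.mk (terminal.from U) w₁ w (e ≫ w₁) f hw (hw.assoc_left hj.isBinProd) w f d e
    ⟨Subsingleton.elim _ _, rfl⟩ ⟨Subsingleton.elim _ _, rfl⟩
    ⟨by simp [reassoc_of% hj.comp_fst], hd⟩ ⟨by simp, by simp [f]⟩ (toTopOver w _).hom β.hom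
    φ'.hom (isCart_top _) hβ φ'.isHomLift hφ'.symm σ.hom ρ.hom (hρ.of_section hσρ hj.comp_fst) hρ
    hσρ (𝟙 A) (terminal.from A) π₁' π₂' (.symm (.of_terminal A))
    (hj.isJointlyCart.isBinProd hρ hβ h₁ h₂) j.hom j.isHomLift ?_ ?_
  · refine hρ.ext (j.comp (.ofFiber π₁')) ((HomOver.ofFiber (𝟙 A)).comp σ) ?_
    simp [h₁, hj.hom_fst, hσρ]
  · refine hβ.ext (j.comp (.ofFiber π₂')) ((HomOver.ofFiber (terminal.from A)).comp φ') ?_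
    simp only [HomOver.comp_hom, HomOver.ofFiber_hom, Category.assoc, h₂, hj.hom_snd, hφ']
    exact congrArg (· ≫ (l.refl w).hom) (top_ext _ (.ofFiber _))

/-- The factor `A'` of the domain of a `BCFR` arrow is terminal, so the first projection of the
domain is an isomorphism; composing its inverse with the retraction `ρ` gives the first component of
the jointly cartesian pair. -/
lemma BCFRClass.reflClass {l : Loop p X} {a b : E} {ψ : a ⟶ b} (h : l.BCFRClass ψ) :
    l.ReflClass ψ := by
  obtain @⟨U, UX, UY, g, x₁, x₂, y₁, y₂, hx, hy, gX, gY, Us, Ur, hgX, hgY, hUs, hUr, A', C, P, D',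
    C', Q, α, β, φ', hα, hβ, hφ', comm, σ, ρ, hσ, hρ, split, π₁, π₂, π₁', π₂', hP, hQ, ψ, hψ, h₁,
    h₂⟩ := h
  obtain rfl : gX = x₂ := by simpa using hgX.2
  obtain rfl : gY = y₂ := by simpa using hgY.2
  have hs₁ : Us ≫ y₁ = x₁ := by simpa using hUs.1
  have hs₂ : Us ≫ gY = prod.lift gX gX := by simpa using hUs.2
  have hr₁ : Ur ≫ x₁ = y₁ := by simpa using hUr.1
  have hr₂ : Ur ≫ gX = gY ≫ prod.fst := hUr.2
  let αo : HomOver gX A' (⊤_ (p.Fiber X)) := ⟨α, inferInstance⟩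
  let βo : HomOver gY D' l.obj := ⟨β, inferInstance⟩
  let ρo : HomOver Ur C' C := ⟨ρ, inferInstance⟩
  let ψo : HomOver Us P Q := ⟨ψ, hψ⟩
  have : IsIso (HomOver.ofFiber π₁).hom := hP.isIso_fst (α := αo) hα
  let ν := (HomOver.ofFiber π₁).inv
  have hgY' : gY = prod.lift (Ur ≫ gX) (gY ≫ prod.snd) := by ext <;> simp [hr₂]
  let k₁ : HomOver Ur Q P := ((HomOver.ofFiber π₁').comp (ρo.comp ν)).cast
  let k₂ : HomOver (prod.lift (Ur ≫ gX) (gY ≫ prod.snd)) Q l.obj :=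
    ((HomOver.ofFiber π₂').comp βo).cast (by simpa using hgY')
  have hd₁ : Us ≫ Ur = 𝟙 UX :=
    hx.hom_ext (by simp [hr₁, hs₁]) (by simp [hr₂, reassoc_of% hs₂])
  refine ReflClass.mk (k₁ := k₁) (k₂ := k₂) (j := ψo) hx
    { isBinProd := (IsBinProd.of_prod X X).assoc_right hx hy hr₁ hr₂
      comp_fst := hd₁
      comp_snd := by simp [reassoc_of% hs₂]
      isJointlyCart :=
        hQ.isJointlyCart.comp_cart (HomOver.IsCart.comp (φ := ρo) hρ (.of_isIso ν)) (β := βo) hβ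
          rfl rfl (by simp) (by simpa using hgY'.symm)
      hom_fst := ?_
      hom_snd := ?_ }
  · change ψ ≫ und π₁' ≫ ρ ≫ ν.hom = _
    rw [reassoc_of% h₁, reassoc_of% split]
    exact IsIso.hom_inv_id (HomOver.ofFiber π₁).hom
  · change ψ ≫ und π₂' ≫ β = _
    rw [reassoc_of% h₂, ← comm, toTopOver_comp_refl, ← Category.assoc]
    exact congrArg (· ≫ l.arr) (top_ext ((HomOver.ofFiber π₂).comp αo) _)

lemma isUniversal_iff_bcfrClass {l : Loop p X} :
    l.IsUniversal ↔ ∀ {a b : E} (ψ : a ⟶ b), l.BCFRClass ψ → cocartOver p ParamDiag ψ :=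
  isUniversal_iff_reflClass.trans
    ⟨fun H _ _ ψ h => H ψ h.reflClass, fun H _ _ ψ h => H ψ h.bcfrClass⟩

lemma IsUniversal.of_productStable_of_pairable
    (stable : ProductStable p ParamDiag (cocartOver p ParamDiag))
    (pairable : Pairable p (cocartOver p ParamDiag)) {l : Loop p X}
    (hl : p.IsStronglyCocartesian (dia X) l.arr) : l.IsUniversal := by
  refine isUniversal_iff_bcfrClass.2 fun ψ h => ?_
  obtain @⟨U, UX, UY, g, x₁, x₂, y₁, y₂, hx, hy, gX, gY, Us, Ur, hgX, hgY, hUs, -, A', C, P, D',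
    C', Q, α, β, φ', hα, hβ, hφ', comm, σ, -, hσ, -, -, π₁, π₂, π₁', π₂', hP, hQ, ψ, hψ, e₁,
    e₂⟩ := h
  have hφ : cocartOver p ParamDiag φ' :=
    stable g (dia X) (paramDiag_dia X) x₁ x₂ (terminal.from X) (𝟙 X) y₁ y₂
      (terminal.from (X ⨯ X)) (𝟙 (X ⨯ X)) hx (.of_terminal X) hy (.of_terminal _) gX gY Us (dia X)
      hgX hgY hUs ⟨Subsingleton.elim _ _, by simp [dia]⟩ φ' l.arr α β hφ' inferInstance hα hβ comm
      (l.arrOver.cocartOver_iff.2 ⟨hl, paramDiag_dia X⟩)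
  exact pairable Us φ' σ π₂ π₁ π₂' π₁' ψ hφ' hσ hP.symm hQ.symm hψ e₂ e₁ hφ

end Loop

end Loops

section Transport

variable [HasFiniteProducts B] [p.IsFibered] [HasFibredProducts p]

namespace IsUniversal

variable {X W : B} {w : W ⟶ X} {Q : p.Fiber (X ⨯ X)} {r : HomOver (w ≫ dia X) (⊤_ (p.Fiber W)) Q}
  {Γ Γ' : B} {G : p.Fiber Γ} {G' : p.Fiber Γ'} {h : Γ' ⟶ Γ} {f : Γ ⟶ W} {g : Γ ⟶ X ⨯ X}
  {f' : Γ' ⟶ W} {g' : Γ' ⟶ X ⨯ X}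

section Reverse

/-- Symmetry of the equality predicate `Q`, at equalities whose source is the image of `f`. -/
noncomputable def reverse (H : IsUniversal r) (f : Γ ⟶ W) (e : HomOver g G Q)
    (hg : g ≫ prod.fst = f ≫ w := by simp) :
    HomOver (prod.lift (g ≫ prod.snd) (g ≫ prod.fst)) G Q :=
  (((isJointlyCart_act w Q _).lift (prod.lift f (g ≫ prod.snd)) (toTopOver f G) e
      (by simp) (by ext <;> simp [hg])).comp
    ((H.isCocart_actPt _).desc r (prod.lift prod.snd (prod.fst ≫ w)))).cast (by simp [hg])

lemma comp_reverse (H : IsUniversal r) (φ : HomOver h G' G) {e : HomOver g G Q}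
    {e' : HomOver g' G' Q} {hg : g ≫ prod.fst = f ≫ w} {hg' : g' ≫ prod.fst = f' ≫ w}
    (he : φ.hom ≫ e.hom = e'.hom) (ef : f' = h ≫ f := by simp) (eg : g' = h ≫ g := by simp) :
    φ.hom ≫ (H.reverse f e hg).hom = (H.reverse f' e' hg').hom := by
  subst ef eg
  simp only [reverse, HomOver.cast_hom, HomOver.comp_hom, ← Category.assoc]
  congr 1
  exact (isJointlyCart_act w Q _).ext (φ.comp _) _ (by simp) (by simp [he])

lemma reverse_refl (H : IsUniversal r) {e : HomOver g G Q} {hg : g ≫ prod.fst = f ≫ w}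
    (he : e.hom = (toTopOver f G).hom ≫ r.hom) (eg : g = prod.lift (f ≫ w) (f ≫ w) := by simp) :
    (H.reverse f e hg).hom = e.hom := by
  have factor := (isJointlyCart_act w Q _).ext ((isJointlyCart_act w Q _).lift
      (prod.lift f (g ≫ prod.snd)) (toTopOver f G) e (by simp) (by ext <;> simp [hg]))
    ((toTopOver f G).comp (actPt _ r)) (by simp [(isReflArrow_actPt r).hom_fst])
    (by simp [(isReflArrow_actPt r).hom_snd, he]) (by simp [eg])
  rw [reverse, HomOver.cast_hom, HomOver.comp_hom, factor, he]
  simp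

end Reverse

section Transport

variable {U : B} {w₁ : W ⟶ U} {A : p.Fiber W}

/-- Transport of `a` along the equality `e`, whose source is the second component of the base point
of `a`; the parameter in `U` is unchanged. -/
noncomputable def transport (H : IsUniversal r) (hw : IsBinProd w₁ w) (a : HomOver f G A)
    (e : HomOver g G Q) (hg : g ≫ prod.fst = f ≫ w := by simp) :
    HomOver (hw.lift (f ≫ w₁) (g ≫ prod.snd)) G A :=
  (((isJointlyCart_act w Q A).lift (prod.lift f (g ≫ prod.snd)) a e
      (by simp) (by ext <;> simp [hg])).comp
    ((H.isCocart_actPt A).desc (.id A) (hw.lift (prod.fst ≫ w₁) prod.snd)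
      (hw.hom_ext (by simp) (by simp)))).cast (by simp)

lemma comp_transport (H : IsUniversal r) (hw : IsBinProd w₁ w) (φ : HomOver h G' G)
    {a : HomOver f G A} {e : HomOver g G Q} {a' : HomOver f' G' A} {e' : HomOver g' G' Q}
    {hg : g ≫ prod.fst = f ≫ w} {hg' : g' ≫ prod.fst = f' ≫ w} (ha : φ.hom ≫ a.hom = a'.hom)
    (he : φ.hom ≫ e.hom = e'.hom) (ef : f' = h ≫ f := by simp) (eg : g' = h ≫ g := by simp) :
    φ.hom ≫ (H.transport hw a e hg).hom = (H.transport hw a' e' hg').hom := by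
  subst ef eg
  simp only [transport, HomOver.cast_hom, HomOver.comp_hom, ← Category.assoc]
  congr 1
  exact (isJointlyCart_act w Q A).ext (φ.comp _) _ (by simp [ha]) (by simp [he])

lemma transport_refl (H : IsUniversal r) (hw : IsBinProd w₁ w) {a : HomOver f G A}
    {e : HomOver g G Q} {hg : g ≫ prod.fst = f ≫ w} (he : e.hom = (toTopOver f G).hom ≫ r.hom)
    (eg : g = prod.lift (f ≫ w) (f ≫ w) := by simp) : (H.transport hw a e hg).hom = a.hom := by
  have factor := (isJointlyCart_act w Q A).ext ((isJointlyCart_act w Q A).lift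
      (prod.lift f (g ≫ prod.snd)) a e (by simp) (by ext <;> simp [hg]))
    (a.comp (actPt A r)) (by simp [(isReflArrow_actPt r).hom_fst])
    (by
      simp only [HomOver.comp_hom, Category.assoc, (isReflArrow_actPt r).hom_snd, he,
        IsJointlyCart.lift_snd, comp_toTopOver_assoc]
      exact congrArg (· ≫ r.hom) (top_ext _ _))
    (by simp [eg])
  rw [transport, HomOver.cast_hom, HomOver.comp_hom, factor]
  simp

lemma comp_transport_of_refl (H : IsUniversal r) (hw : IsBinProd w₁ w) (φ : HomOver h G' G)
    {a : HomOver f G A} {e : HomOver g G Q} {hg : g ≫ prod.fst = f ≫ w}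
    (he : φ.hom ≫ e.hom = (toTopOver (h ≫ f) G').hom ≫ r.hom)
    (eg : h ≫ g = prod.lift ((h ≫ f) ≫ w) ((h ≫ f) ≫ w) := by simp) :
    φ.hom ≫ (H.transport hw a e hg).hom = φ.hom ≫ a.hom :=
  (H.comp_transport hw φ (a' := φ.comp a) (e' := φ.comp e) (hg' := by simp [hg]) rfl rfl).trans
    (H.transport_refl hw he eg)

lemma transport_transport_reverse (H : IsUniversal r) (hw : IsBinProd w₁ w) (a : HomOver f G A)
    (e : HomOver g G Q) (hg : g ≫ prod.fst = f ≫ w) :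
    (H.transport hw (H.transport hw a e hg) (H.reverse f e hg)).hom = a.hom := by
  let τ := H.transport hw (H.transport hw (actFst w Q A) (actSnd w Q A))
    (H.reverse prod.fst (actSnd w Q A))
  have generic : τ.hom = (actFst w Q A).hom := by
    refine (H.isCocart_actPt A).ext τ (actFst w Q A) ?_ (hw.hom_ext (by simp) (by simp))
    let e₀ := (toTopOver (𝟙 W) A).comp r
    have e₀_snd : (actPt A r).hom ≫ (actSnd w Q A).hom = e₀.hom := (isReflArrow_actPt r).hom_snd
    calc (actPt A r).hom ≫ τ.hom
        = (H.transport hw (H.transport hw (.id A) e₀) (H.reverse (𝟙 W) e₀)).hom :=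
          H.comp_transport hw _ (H.comp_transport hw _ (isReflArrow_actPt r).hom_fst e₀_snd)
            (H.comp_reverse _ e₀_snd)
      _ = (H.transport hw (.id A) e₀).hom := H.transport_refl hw
          ((H.reverse_refl (e := e₀) rfl).trans (congrArg (· ≫ r.hom) (top_ext _ _
            (hw.hom_ext (by simp) (by simp))))) (by ext <;> simp)
      _ = 𝟙 _ := H.transport_refl hw rfl
      _ = _ := (isReflArrow_actPt r).hom_fst.symm
  let κ := (isJointlyCart_act w Q A).lift (prod.lift f (g ≫ prod.snd)) a e (by simp)
    (by ext <;> simp [hg])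
  calc _ = κ.hom ≫ τ.hom := (H.comp_transport hw κ
          (H.comp_transport hw κ (by simp [κ]) (by simp [κ]) (by simp) (by ext <;> simp [hg]))
          (H.comp_reverse κ (by simp [κ]) (by simp) (by ext <;> simp [hg]))
          (by simp) (by ext <;> simp [hg])).symm
    _ = a.hom := by simp [generic, κ]

lemma reverse_reverse (H : IsUniversal r) (hw : IsBinProd w₁ w) {f f' : Γ ⟶ W}
    (e : HomOver g G Q) (hg : g ≫ prod.fst = f ≫ w) (hg' : g ≫ prod.snd = f' ≫ w)
    (hf : f' ≫ w₁ = f ≫ w₁) : (H.reverse f' (H.reverse f e hg) (by simp [hg'])).hom = e.hom := by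
  let σ := H.reverse (hw.lift (prod.fst ≫ w₁) prod.snd)
    (H.reverse prod.fst (actSnd w Q (⊤_ (p.Fiber W))))
  have generic : σ.hom = (actSnd w Q _).hom := by
    refine (H.isCocart_actPt _).ext σ (actSnd w Q _) ?_
    let e₀ := (toTopOver (𝟙 W) (⊤_ (p.Fiber W))).comp r
    have e₀_snd : (actPt _ r).hom ≫ (actSnd w Q _).hom = e₀.hom := (isReflArrow_actPt r).hom_snd
    calc (actPt _ r).hom ≫ σ.hom
        = (H.reverse (𝟙 W) (H.reverse (𝟙 W) e₀)).hom :=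
          H.comp_reverse _ (H.comp_reverse _ e₀_snd) (hw.hom_ext (by simp) (by simp))
      _ = (H.reverse (𝟙 W) e₀).hom := H.reverse_refl (H.reverse_refl rfl)
      _ = e₀.hom := H.reverse_refl rfl
      _ = _ := e₀_snd.symm
  let κ := (isJointlyCart_act w Q _).lift (prod.lift f (g ≫ prod.snd)) (toTopOver f G) e (by simp)
    (by ext <;> simp [hg])
  calc _ = κ.hom ≫ σ.hom := (H.comp_reverse κ
          (H.comp_reverse κ (by simp [κ]) (by simp) (by ext <;> simp [hg]))
          (hw.hom_ext (by simp [hf]) (by simp [hg'])) (by ext <;> simp [hg])).symm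
    _ = e.hom := by simp [generic, κ]

lemma transport_reverse_transport (H : IsUniversal r) (hw : IsBinProd w₁ w) {f' : Γ ⟶ W}
    (a : HomOver f' G A) (e : HomOver g G Q) (hg : g ≫ prod.fst = f ≫ w)
    (hg' : g ≫ prod.snd = f' ≫ w) (hf : f' ≫ w₁ = f ≫ w₁) :
    (H.transport hw (H.transport hw a (H.reverse f e hg) (by simp [hg'])) e).hom = a.hom := by
  refine Eq.trans ?_ (H.transport_transport_reverse hw a (H.reverse f e hg) (by simp [hg']))
  refine (Category.id_comp _).symm.trans
    (H.comp_transport hw (.id G) (by simp) ?_ (by simp) (by ext <;> simp))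
  simp [H.reverse_reverse hw e hg hg' hf]

end Transport

end IsUniversal

end Transport

section Transporters

variable [HasFiniteProducts B]

namespace IsBinProd

variable {C : Type u₁} [Category.{v₁} C] [HasFiniteProducts C]

lemma prod_snd_fst (A X Y : C) :
    IsBinProd (prod.lift prod.fst (prod.snd ≫ prod.snd) : A ⨯ (X ⨯ Y) ⟶ A ⨯ Y)
      (prod.snd ≫ prod.fst) :=
  of_exists_lift
    (fun f g => ⟨prod.lift (f ≫ prod.fst) (prod.lift g (f ≫ prod.snd)), by ext <;> simp, by simp⟩)
    fun h h' e₁ e₂ => by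
      ext
      · simpa using e₁ =≫ prod.fst
      · simpa using e₂
      · simpa using e₁ =≫ prod.snd

lemma prod_snd_snd (A X Y : C) :
    IsBinProd (prod.lift prod.fst (prod.snd ≫ prod.fst) : A ⨯ (X ⨯ Y) ⟶ A ⨯ X)
      (prod.snd ≫ prod.snd) :=
  of_exists_lift
    (fun f g => ⟨prod.lift (f ≫ prod.fst) (prod.lift (f ≫ prod.snd) g), by ext <;> simp, by simp⟩)
    fun h h' e₁ e₂ => by
      ext
      · simpa using e₁ =≫ prod.fst
      · simpa using e₁ =≫ prod.snd
      · simpa using e₂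

end IsBinProd

variable [p.IsFibered] [HasFibredProducts p]

namespace Loop

variable {X Y : B} (l : Loop p X) (m : Loop p Y)

/-- The arrow `pr₁^* A ∧ Eq_X ⟶ A` over `pr₁`. -/
noncomputable def actFst (A : p.Fiber X) : HomOver prod.fst (l.act A) A :=
  ((HomOver.ofFiber prod.fst).comp (reindexHom prod.fst A)).cast

/-- The arrow `pr₁^* A ∧ Eq_X ⟶ Eq_X` over the identity, which is written as a pairing. -/
noncomputable def actSnd (A : p.Fiber X) :
    HomOver (prod.lift (prod.fst ≫ 𝟙 X) prod.snd) (l.act A) l.obj :=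
  (HomOver.ofFiber prod.snd).cast

/-- The arrow `δ_A`, bundled with the diagonal. -/
noncomputable def pointOver (A : p.Fiber X) : HomOver (dia X) A (l.act A) :=
  ⟨l.point A, pair_isHomLift p _ _ _⟩

lemma isReflArrow_point (A : p.Fiber X) :
    IsReflArrow (l.refl (𝟙 X)) (l.actFst A) (l.actSnd A) (l.pointOver A) where
  isBinProd := .of_prod X X
  comp_fst := by simp [dia]
  comp_snd := by simp [dia]
  isJointlyCart :=
    (IsBinProd.of_prod _ _).isJointlyCart.comp_cart (isCart_reindexHom prod.fst A) (.id l.obj)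
      rfl (by simp [actSnd])
  hom_fst := by
    change pair p _ _ _ ≫ und prod.fst ≫ cart p prod.fst A = _
    rw [← Category.assoc, pair_fst]
    exact cartLift_cart p _ _ _
  hom_snd := by
    change pair p _ _ _ ≫ und prod.snd = _
    rw [pair_snd, toTopOver_comp_refl]
    exact congrArg (· ≫ l.arr) (top_ext (.ofFiber (terminal.from A)) _)

/-- The arrow `Eq_X ⊠ Eq_Y ⟶ Eq_X` over `⟨1,3⟩`. -/
noncomputable def boxProjFst : HomOver (pr13 X Y) (l.box m) l.obj := jointFst _ _ l.obj m.obj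

/-- The arrow `Eq_X ⊠ Eq_Y ⟶ Eq_Y` over `⟨2,4⟩`. -/
noncomputable def boxProjSnd : HomOver (pr24 X Y) (l.box m) m.obj := jointSnd _ _ l.obj m.obj

lemma isJointlyCart_box : IsJointlyCart (l.boxProjFst m) (l.boxProjSnd m) :=
  isJointlyCart_joint _ _ l.obj m.obj

/-- The arrow `δ_X ⊠ δ_Y`, bundled with the diagonal. -/
noncomputable def boxOver : HomOver (dia (X ⨯ Y)) (⊤_ (p.Fiber (X ⨯ Y))) (l.box m) :=
  ⟨l.boxArr m, pair_isHomLift p _ _ _⟩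

@[simp]
lemma boxOver_hom : (l.boxOver m).hom = l.boxArr m := rfl

lemma boxArr_comp_boxProjFst :
    l.boxArr m ≫ (l.boxProjFst m).hom = (toTopOver prod.fst _).hom ≫ l.arr := by
  change pair p _ _ _ ≫ und prod.fst ≫ cart p _ _ = _
  rw [← Category.assoc, pair_fst]
  exact cartLift_cart p _ _ _

lemma boxArr_comp_boxProjSnd :
    l.boxArr m ≫ (l.boxProjSnd m).hom = (toTopOver prod.snd _).hom ≫ m.arr := by
  change pair p _ _ _ ≫ und prod.snd ≫ cart p _ _ = _
  rw [← Category.assoc, pair_snd]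
  exact cartLift_cart p _ _ _

variable {l m}

/-- Transporting reflexivity of `Eq_{X × Y}` first along `Eq_X`, then along `Eq_Y`. -/
lemma IsUniversal.exists_box_hom (hl : l.IsUniversal) (hm : m.IsUniversal) (n : Loop p (X ⨯ Y)) :
    ∃ χ : l.box m ⟶ n.obj, l.boxArr m ≫ und χ = n.arr := by
  have hw := IsBinProd.prod_snd_fst (X ⨯ Y) X Y
  have hw' := IsBinProd.prod_snd_snd (X ⨯ Y) X Y
  let a₀ : HomOver (prod.fst ≫ dia (X ⨯ Y)) (l.box m) n.obj :=
    (toTopOver prod.fst _).comp n.arrOver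
  let a₁ : HomOver (prod.lift prod.fst (prod.lift (prod.snd ≫ prod.fst) (prod.fst ≫ prod.snd)))
      (l.box m) n.obj :=
    ((hl hw).transport hw a₀ (l.boxProjFst m) (by simp [pr13])).cast
      (hw.hom_ext ((hw.lift_fst _ _).trans (by ext <;> simp)) (by simp [pr13]))
  let a₂ : HomOver (𝟙 _) (l.box m) n.obj :=
    ((hm hw').transport hw' a₁ (l.boxProjSnd m) (by simp [pr24])).cast
      (hw'.hom_ext ((hw'.lift_fst _ _).trans (by ext <;> simp)) (by simp [pr24]))
  have δ_a₀ : l.boxArr m ≫ a₀.hom = n.arr := by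
    rw [← boxOver_hom, HomOver.comp_hom, comp_toTopOver_assoc]
    exact (congrArg (· ≫ n.arr) (top_ext _ (.id _) (by simp [dia]))).trans (Category.id_comp _)
  have δ_a₁ : l.boxArr m ≫ a₁.hom = l.boxArr m ≫ a₀.hom := by
    refine (hl hw).comp_transport_of_refl hw (l.boxOver m)
      (hg := by simp [pr13]) ?_ (by ext <;> simp [pr13, dia])
    rw [boxOver_hom, boxArr_comp_boxProjFst, toTopOver_comp_refl]
    exact congrArg (· ≫ l.arr) (top_ext _ _ (by simp [dia]))
  have δ_a₂ : l.boxArr m ≫ a₂.hom = l.boxArr m ≫ a₁.hom := by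
    refine (hm hw').comp_transport_of_refl hw' (l.boxOver m)
      (hg := by simp [pr24]) ?_ (by ext <;> simp [pr24, dia])
    rw [boxOver_hom, boxArr_comp_boxProjSnd, toTopOver_comp_refl]
    exact congrArg (· ≫ m.arr) (top_ext _ _ (by simp [dia]))
  exact ⟨a₂.toFiber, δ_a₂.trans (δ_a₁.trans δ_a₀)⟩

end Loop

end Transporters

section StrictTransporters

variable [HasFiniteProducts B] [p.IsFibered] [HasFibredProducts p]

namespace Loop

lemma IsUniversal.exists_strictTransporter {X : B} {l : Loop p X} (H : l.IsUniversal) :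
    ∃ T : StrictTransporter p X, T.toLoop = l := by
  let T (A : p.Fiber X) : HomOver prod.snd (l.act A) A :=
    (H (.of_terminal X) (l.isReflArrow_point A)).desc (.id A) prod.snd (by simp [dia])
  have hT (A : p.Fiber X) : l.point A ≫ (T A).hom = 𝟙 (tot A) :=
    (H (.of_terminal X) (l.isReflArrow_point A)).fac (.id A) prod.snd (by simp [dia])
  exact ⟨⟨l, fun A => (T A).hom, fun A => (T A).isHomLift, hT⟩, rfl⟩

lemma exists_strictlyProductive {l : ∀ X : B, Loop p X} (H : ∀ X, (l X).IsUniversal) :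
    ∃ T : ∀ X : B, StrictTransporter p X, StrictlyProductive (fun X => (T X).toLoop) ∧
      ∀ (X : B) {a b : E} (ψ : a ⟶ b), (T X).toLoop.BCFRClass ψ →
        fibEpic p ψ ∧ ParamDiag (p.map ψ) := by
  choose T hT using fun X => (H X).exists_strictTransporter
  obtain rfl : (fun X => (T X).toLoop) = l := funext hT
  refine ⟨T, fun X Y => (H X).exists_box_hom (H Y) _, fun X a b ψ hψ => ?_⟩
  have h : cocartOver p ParamDiag ψ := isUniversal_iff_bcfrClass.1 (H X) ψ hψ
  exact ⟨h.fibEpic, h.2⟩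

end Loop

namespace StrictTransporter

/-- `ξ` transports `ψ a : G (x, w x)` along the equality of `(x, w x)` and `(x, y)` obtained
from an equality of `w x` and `y`. -/
lemma exists_actPt_comp {W X : B} (T : StrictTransporter p (W ⨯ X)) {l : Loop p W} {m : Loop p X}
    (χ : l.box m ⟶ T.obj) (hχ : l.boxArr m ≫ und χ = T.arr) {w : W ⟶ X} {A : p.Fiber W}
    {G : p.Fiber (W ⨯ X)} (ψ : HomOver (prod.lift (𝟙 W) w) A G) :
    ∃ ξ : HomOver (𝟙 _) (act w m.obj A) G, (actPt A (m.refl w)).hom ≫ ξ.hom = ψ.hom := by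
  let d := prod.lift (𝟙 W) w
  let j := actPt A (m.refl w)
  have hj := isReflArrow_actPt (A := A) (m.refl w)
  let f : W ⨯ X ⟶ (W ⨯ X) ⨯ (W ⨯ X) := prod.lift (prod.fst ≫ d) (𝟙 _)
  let b : HomOver f (act w m.obj A) (l.box m) :=
    (l.isJointlyCart_box m).lift f ((toTopOver prod.fst _).comp l.arrOver) (actSnd w m.obj A)
      (by ext <;> simp [f, d, pr13, dia]) (by ext <;> simp [f, d, pr24])
  let c : HomOver f (act w m.obj A) (T.act G) :=
    (T.isReflArrow_point G).isJointlyCart.lift f ((actFst w m.obj A).comp ψ)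
      (b.comp (.ofFiber χ)) (by simp [f, d]) (by simp)
  let t : HomOver prod.snd (T.act G) G := ⟨T.carrier G, T.carrier_isHomLift G⟩
  have j_b : j.hom ≫ b.hom = (toTopOver d A).hom ≫ l.boxArr m := by
    refine (l.isJointlyCart_box m).ext (j.comp b) ((toTopOver d A).comp (l.boxOver m)) ?_ ?_
      (by ext <;> simp [f, d, dia])
    · have : j.hom ≫ b.hom ≫ (l.boxProjFst m).hom = (toTopOver (d ≫ prod.fst) A).hom ≫ l.arr := by
        simp [b, d]
      simpa [l.boxArr_comp_boxProjFst m] using this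
    · have : j.hom ≫ b.hom ≫ (l.boxProjSnd m).hom = (toTopOver (d ≫ prod.snd) A).hom ≫ m.arr := by
        simp only [b, j, IsJointlyCart.lift_snd, hj.hom_snd, Loop.toTopOver_comp_refl]
        exact congrArg (· ≫ m.arr) (top_ext _ _ (by simp [d]))
      simpa [l.boxArr_comp_boxProjSnd m] using this
  have j_c : j.hom ≫ c.hom = ψ.hom ≫ T.point G := by
    refine (T.isReflArrow_point G).isJointlyCart.ext (j.comp c) (ψ.comp (T.pointOver G)) ?_ ?_
      (by ext <;> simp [f, d, dia])
    · have := (T.isReflArrow_point G).hom_fst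
      simp [c, j, this, reassoc_of% hj.hom_fst]
    · have := (T.isReflArrow_point G).hom_snd
      simp only [c, HomOver.comp_hom, Category.assoc, IsJointlyCart.lift_snd, this,
        HomOver.ofFiber_hom, reassoc_of% j_b, hχ, Loop.toTopOver_comp_refl, comp_toTopOver_assoc]
      exact congrArg (· ≫ T.arr) (top_ext _ _ (by simp [d]))
  refine ⟨(c.comp t).cast (by simp [f]), ?_⟩
  change j.hom ≫ c.hom ≫ T.carrier G = ψ.hom
  rw [reassoc_of% j_c, T.strict, Category.comp_id]

end StrictTransporter

lemma Loop.isUniversal_of_strictTransporter (T : ∀ X : B, StrictTransporter p X)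
    (hT : StrictlyProductive fun X => (T X).toLoop) {X : B}
    (H : ∀ {a b : E} (ψ : a ⟶ b), (T X).toLoop.BCFRClass ψ → fibEpic p ψ) :
    (T X).toLoop.IsUniversal := by
  refine .of_prod fun U => .of_isCocart_actPt fun A => .of_vertical _ (fun G ψ => ?_) ?_
  · obtain ⟨χ, hχ⟩ := hT (U ⨯ X) X
    exact (T _).exists_actPt_comp χ hχ ψ
  · exact fun G => HomOver.ext_of_fibEpic (H _
      (Loop.ReflClass.mk (.of_prod U X) (isReflArrow_actPt _)).bcfrClass)

end StrictTransporters

section Adjunctions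

variable {X Y : B} {f : X ⟶ Y}

lemma HomOver.IsCocart.vertical_ext {A : p.Fiber X} {C D : p.Fiber Y} {u : HomOver f A C}
    (hu : u.IsCocart) {a b : C ⟶ D} (h : u.hom ≫ und a = u.hom ≫ und b) : a = b :=
  und_ext (hu.ext (.ofFiber a) (.ofFiber b) h)

variable [p.IsFibered]

lemma vertical_ext {A : p.Fiber X} {D : p.Fiber Y} {a b : A ⟶ (reindex p f).obj D}
    (h : und a ≫ (reindexHom f D).hom = und b ≫ (reindexHom f D).hom) : a = b :=
  und_ext ((isCart_reindexHom f D).ext (.ofFiber a) (.ofFiber b) h)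

namespace HomOver.IsCocart

variable {A : p.Fiber X} {C : p.Fiber Y} {u : HomOver f A C}

/-- Vertical arrows out of the codomain of a cocartesian arrow over `f` correspond to vertical
arrows into the reindexing along `f`. -/
noncomputable def homEquiv (hu : u.IsCocart) (D : p.Fiber Y) :
    (C ⟶ D) ≃ (A ⟶ (reindex p f).obj D) where
  toFun χ := ((isCart_reindexHom f D).lift (u.comp (.ofFiber χ)) (𝟙 X)).toFiber
  invFun a := (hu.desc ((HomOver.ofFiber a).comp (reindexHom f D)) (𝟙 Y)).toFiber
  left_inv χ := hu.vertical_ext (by simp)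
  right_inv a := ElemFib.vertical_ext (by simp)

lemma homEquiv_comp (hu : u.IsCocart) {D : p.Fiber Y} (χ : C ⟶ D) :
    und (hu.homEquiv D χ) ≫ (reindexHom f D).hom = u.hom ≫ und χ := by
  simp [homEquiv]

lemma homEquiv_symm_comp (hu : u.IsCocart) {D : p.Fiber Y} (a : A ⟶ (reindex p f).obj D) :
    u.hom ≫ und ((hu.homEquiv D).symm a) = und a ≫ (reindexHom f D).hom := by
  simp [homEquiv]

end HomOver.IsCocart

lemma nonempty_adjunction_of_isCocart (F : p.Fiber X ⥤ p.Fiber Y)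
    (u : ∀ A, HomOver f A (F.obj A)) (hu : ∀ A, (u A).IsCocart)
    (nat : ∀ {A A' : p.Fiber X} (φ : A ⟶ A'), (u A).hom ≫ und (F.map φ) = und φ ≫ (u A').hom) :
    Nonempty (F ⊣ reindex p f) :=
  ⟨Adjunction.mkOfHomEquiv
    { homEquiv A D := (hu A).homEquiv D
      homEquiv_naturality_left_symm {A A' D} φ a := (hu A).vertical_ext <| by
        rw [HomOver.IsCocart.homEquiv_symm_comp, und_comp, und_comp, reassoc_of% nat,
          HomOver.IsCocart.homEquiv_symm_comp, Category.assoc]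
      homEquiv_naturality_right {A D D'} χ ξ := vertical_ext <| by
        rw [HomOver.IsCocart.homEquiv_comp, und_comp, und_comp, Category.assoc,
          ← reindexHom_comp_und, ← Category.assoc, ← Category.assoc,
          HomOver.IsCocart.homEquiv_comp] }⟩

variable {L : p.Fiber X ⥤ p.Fiber Y} (adj : L ⊣ reindex p f)

/-- The unit of an adjunction `L ⊣ f^*`, as an arrow `A ⟶ L A` over `f`. -/
noncomputable def unitOver (A : p.Fiber X) : HomOver f A (L.obj A) :=
  ((HomOver.ofFiber (adj.unit.app A)).comp (reindexHom f (L.obj A))).cast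

lemma unitOver_comp_und {A : p.Fiber X} {D : p.Fiber Y} (χ : L.obj A ⟶ D) :
    (unitOver adj A).hom ≫ und χ = und (adj.homEquiv A D χ) ≫ (reindexHom f D).hom := by
  rw [Adjunction.homEquiv_unit, und_comp, Category.assoc, ← reindexHom_comp_und]
  simp [unitOver]

lemma isCocart_unitOver (A : p.Fiber X) : (unitOver adj A).IsCocart := by
  refine .of_vertical _ (fun D ψ => ?_) fun D χ χ' h => ?_
  · let a := ((isCart_reindexHom f D).lift ψ (𝟙 X)).toFiber
    refine ⟨.ofFiber ((adj.homEquiv A D).symm a), ?_⟩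
    rw [HomOver.ofFiber_hom, unitOver_comp_und, Equiv.apply_symm_apply]
    simp [a]
  · refine congrArg und (a₁ := χ.toFiber) (a₂ := χ'.toFiber)
      ((adj.homEquiv A D).injective (vertical_ext ?_))
    rw [← unitOver_comp_und, ← unitOver_comp_und]
    exact h

lemma unitOver_naturality {A A' : p.Fiber X} (φ : A ⟶ A') :
    (unitOver adj A).hom ≫ und (L.map φ) = und φ ≫ (unitOver adj A').hom := by
  rw [unitOver_comp_und, Adjunction.homEquiv_unit, adj.unit_naturality, und_comp]
  simp [unitOver]

end Adjunctions

lemma toTopOver_naturality [p.IsFibered] [HasFibredProducts p] {W Z : B} (f : W ⟶ Z)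
    {A A' : p.Fiber W} (φ : A ⟶ A') :
    und φ ≫ (toTopOver f A').hom = (toTopOver f A).hom :=
  top_ext ((HomOver.ofFiber φ).comp (toTopOver f A')) _

section EqFunctor

variable [HasFiniteProducts B] [p.IsFibered] [HasFibredProducts p]
  {X : B} {Q : p.Fiber (X ⨯ X)} {Y : B}

/-- The functoriality of `A ↦ A ∧ Q`, in terms of `act`. -/
noncomputable def actMap (Q : p.Fiber (X ⨯ X)) {A A' : p.Fiber (Y ⨯ X)} (φ : A ⟶ A') :
    act prod.snd Q A ⟶ act prod.snd Q A' :=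
  (eqFunctor Y Q).map φ

lemma actMap_comp_actFst {A A' : p.Fiber (Y ⨯ X)} (φ : A ⟶ A') :
    und (actMap Q φ) ≫ (actFst prod.snd Q A').hom =
      (actFst prod.snd Q A).hom ≫ und φ := by
  change und (prod.map ((reindex p (pr12 Y X)).map φ) (𝟙 _)) ≫ und prod.fst ≫
    (reindexHom (pr12 Y X) A').hom = (und prod.fst ≫ (reindexHom (pr12 Y X) A).hom) ≫ und φ
  rw [← Category.assoc, ← und_comp, prod.map_fst, und_comp, Category.assoc,
    ← reindexHom_comp_und, Category.assoc]

lemma actMap_comp_actSnd {A A' : p.Fiber (Y ⨯ X)} (φ : A ⟶ A') :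
    und (actMap Q φ) ≫ (actSnd prod.snd Q A').hom = (actSnd prod.snd Q A).hom := by
  change und (prod.map ((reindex p (pr12 Y X)).map φ) (𝟙 _)) ≫ und prod.snd ≫
    (reindexHom (pr23 Y X) Q).hom = und prod.snd ≫ (reindexHom (pr23 Y X) Q).hom
  rw [← Category.assoc, ← und_comp, prod.map_snd, Category.comp_id]

lemma actPt_naturality (r : HomOver ((prod.snd : Y ⨯ X ⟶ X) ≫ dia X) (⊤_ (p.Fiber (Y ⨯ X))) Q)
    {A A' : p.Fiber (Y ⨯ X)} (φ : A ⟶ A') :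
    (actPt A r).hom ≫ und (actMap Q φ) = und φ ≫ (actPt A' r).hom := by
  refine (isJointlyCart_act _ Q A').ext ((actPt A r).comp (.ofFiber (actMap Q φ)))
    ((HomOver.ofFiber φ).comp (actPt A' r)) ?_ ?_
  · simp [actMap_comp_actFst, (isReflArrow_actPt r).hom_fst,
      reassoc_of% (isReflArrow_actPt (A := A) r).hom_fst]
  · simp [actMap_comp_actSnd, (isReflArrow_actPt r).hom_snd,
      reassoc_of% toTopOver_naturality]

lemma IsUniversal.nonempty_adjunction
    {r : HomOver ((prod.snd : Y ⨯ X ⟶ X) ≫ dia X) (⊤_ (p.Fiber (Y ⨯ X))) Q} (H : IsUniversal r) :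
    Nonempty (eqFunctor Y Q ⊣ reindex p (pdia Y X)) :=
  nonempty_adjunction_of_isCocart (eqFunctor Y Q) (fun A => actPt A r) H.isCocart_actPt
    (actPt_naturality r)

/-- The unit of the adjunction is `θ ≫ ⟨1, r !⟩` for a natural endomorphism `θ` of the identity.
Each `θ_A` has a one-sided inverse, which by naturality commutes with it. -/
lemma exists_isUniversal_of_adjunction (adj : eqFunctor Y Q ⊣ reindex p (pdia Y X)) :
    ∃ r : HomOver ((prod.snd : Y ⨯ X ⟶ X) ≫ dia X) (⊤_ (p.Fiber (Y ⨯ X))) Q, IsUniversal r := by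
  let u (A : p.Fiber (Y ⨯ X)) : HomOver (prod.lift (𝟙 _) prod.snd) A (act prod.snd Q A) :=
    unitOver adj A
  have u_nat {A A' : p.Fiber (Y ⨯ X)} (φ : A ⟶ A') :
      (u A).hom ≫ und (actMap Q φ) = und φ ≫ (u A').hom := unitOver_naturality adj φ
  let r : HomOver ((prod.snd : Y ⨯ X ⟶ X) ≫ dia X) (⊤_ (p.Fiber (Y ⨯ X))) Q :=
    ((u _).comp (actSnd _ Q _)).cast (by ext <;> simp)
  let θ (A : p.Fiber (Y ⨯ X)) : HomOver (𝟙 _) A A := ((u A).comp (actFst _ Q A)).cast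
  have θ_nat {A A' : p.Fiber (Y ⨯ X)} (φ : A ⟶ A') : (θ A).hom ≫ und φ = und φ ≫ (θ A').hom := by
    have := u_nat φ =≫ (actFst prod.snd Q A').hom
    rw [Category.assoc, actMap_comp_actFst, Category.assoc] at this
    simpa [θ] using this
  have θ_actPt (A : p.Fiber (Y ⨯ X)) : (θ A).hom ≫ (actPt A r).hom = (u A).hom := by
    refine (isJointlyCart_act _ Q A).ext ((θ A).comp (actPt A r)) (u A) ?_ ?_
    · simp [(isReflArrow_actPt r).hom_fst, θ]
    · have := u_nat (terminal.from A) =≫ (actSnd prod.snd Q _).hom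
      rw [Category.assoc, actMap_comp_actSnd, Category.assoc] at this
      refine Eq.trans ?_ this.symm
      simp only [HomOver.comp_hom, Category.assoc, (isReflArrow_actPt r).hom_snd,
        comp_toTopOver_assoc]
      exact congrArg (· ≫ r.hom) (top_ext _ (.ofFiber (terminal.from A)))
  refine ⟨r, .of_isCocart_actPt fun A => ?_⟩
  have hu : (u A).IsCocart := isCocart_unitOver adj A
  let m : HomOver (𝟙 _) A A := ((actPt A r).comp (hu.desc (.id A) prod.fst)).cast
  have θ_m : (θ A).hom ≫ m.hom = 𝟙 _ := by simp [m, reassoc_of% θ_actPt]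
  have m_θ : m.hom ≫ (θ A).hom = 𝟙 _ := (θ_nat m.toFiber).symm.trans θ_m
  have : IsIso m.hom := ⟨_, m_θ, θ_m⟩
  refine ((HomOver.IsCocart.of_isIso m).comp hu).congr ?_
  rw [HomOver.comp_hom, ← θ_actPt, reassoc_of% m_θ]

end EqFunctor

section Points

variable [HasFiniteProducts B] [p.IsFibered] [HasFibredProducts p]

namespace IsUniversal

variable {X W U : B} {w : W ⟶ X} {w₁ : W ⟶ U} {Q : p.Fiber (X ⨯ X)}
  {r : HomOver (w ≫ dia X) (⊤_ (p.Fiber W)) Q}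

/-- Transport along the point `q` of `Q`. -/
noncomputable def transportPt (H : IsUniversal r) (hw : IsBinProd w₁ w)
    (q : HomOver (w ≫ dia X) (⊤_ (p.Fiber W)) Q) (A : p.Fiber W) : HomOver (𝟙 W) A A :=
  (H.transport hw (.id A) ((toTopOver (𝟙 W) A).comp q)).cast (hw.hom_ext (by simp) (by simp))

lemma isIso_transportPt (H : IsUniversal r) (hw : IsBinProd w₁ w)
    (q : HomOver (w ≫ dia X) (⊤_ (p.Fiber W)) Q) (A : p.Fiber W) :
    IsIso (H.transportPt hw q A).hom := by
  let τ := H.transportPt hw q A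
  let e := (toTopOver (𝟙 W) A).comp q
  let e' := H.reverse (𝟙 W) e
  let τ' : HomOver (𝟙 W) A A :=
    (H.transport hw (.id A) e').cast (hw.hom_ext (by simp) (by simp))
  have comp_e (φ : HomOver (𝟙 W) A A) : φ.hom ≫ e.hom = e.hom := by
    simp only [e, HomOver.comp_hom, comp_toTopOver_assoc]
    exact congrArg (· ≫ q.hom) (top_ext _ _)
  refine ⟨τ'.hom, ?_, ?_⟩
  · calc τ.hom ≫ τ'.hom = (H.transport hw (H.transport hw (.id A) e) e').hom :=
          H.comp_transport (hg := by simp) (hg' := by simp) hw τ (by simp [τ, transportPt, e])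
            (H.comp_reverse (hg := by simp) (hg' := by simp) τ (comp_e τ))
            (hw.hom_ext (by simp) (by simp))
      _ = 𝟙 _ := H.transport_transport_reverse hw (.id A) e (by simp)
  · calc τ'.hom ≫ τ.hom = (H.transport hw (H.transport hw (.id A) e') e).hom :=
          H.comp_transport (hg := by simp) (hg' := by simp) hw τ' (by simp [τ']) (comp_e τ')
            (hw.hom_ext (by simp) (by simp))
      _ = 𝟙 _ := H.transport_reverse_transport hw (.id A) e (by simp) (by simp) rfl

/-- Transport with a further parameter in `X` yields the endomorphism `e ↦ r e` of `Q`; it is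
invertible, being the transport along `r`, and it sends `q` to the transport of `r` along `q`. -/
lemma of_point (H : IsUniversal r) (hw : IsBinProd w₁ w)
    {r' : HomOver ((prod.snd : W ⨯ X ⟶ X) ≫ dia X) (⊤_ (p.Fiber (W ⨯ X))) Q}
    (H' : IsUniversal r') (q : HomOver (w ≫ dia X) (⊤_ (p.Fiber W)) Q) : IsUniversal q := by
  refine .of_isCocart_actPt fun A => ?_
  have hX : IsBinProd (prod.fst : W ⨯ X ⟶ W) prod.snd := .of_prod W X
  let T (s : HomOver (w ≫ dia X) (⊤_ (p.Fiber W)) Q) := H'.transportPt hX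
    (((toTopOver (hw.lift (prod.fst ≫ w₁) prod.snd) _).comp s).cast) (act w Q A)
  let c : HomOver (𝟙 _) (act w Q A) (act w Q A) :=
    (H'.transport hX ((actFst w Q A).comp (actPt A r)) (actSnd w Q A)).cast (by ext <;> simp)
  have actPt_c (s : HomOver (w ≫ dia X) (⊤_ (p.Fiber W)) Q) :
      (actPt A s).hom ≫ c.hom = (actPt A r).hom ≫ (T s).hom := by
    let e := (toTopOver (𝟙 W) A).comp s
    calc (actPt A s).hom ≫ c.hom = (H'.transport hX (actPt A r) e).hom :=
          H'.comp_transport (hg := by simp) (hg' := by simp) hX (actPt A s)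
            (by simp [reassoc_of% (isReflArrow_actPt (A := A) s).hom_fst])
            (isReflArrow_actPt s).hom_snd
      _ = (actPt A r).hom ≫ (T s).hom := .symm <|
          H'.comp_transport (hg := by simp) (hg' := by simp) hX (actPt A r) (by simp) (by
            simp only [HomOver.comp_hom, HomOver.cast_hom, comp_toTopOver_assoc, e]
            exact congrArg (· ≫ s.hom) (top_ext _ _ (hw.hom_ext (by simp) (by simp))))
  have c_eq : c.hom = (T r).hom := (H.isCocart_actPt A).ext c (T r) (actPt_c r)
  have : IsIso c.hom := c_eq ▸ H'.isIso_transportPt hX _ _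
  have : IsIso (T q).hom := H'.isIso_transportPt hX _ _
  have hq := ((H.isCocart_actPt A).comp (.of_isIso (T q))).comp (.of_isIso c.inv)
  exact hq.congr (by simp [← actPt_c])

end IsUniversal

namespace Loop

variable {X : B}

lemma isUniversal_of_adjunction {l : Loop p X}
    (H : ∀ Y : B, Nonempty (eqFunctor Y l.obj ⊣ reindex p (pdia Y X))) : l.IsUniversal := by
  refine .of_prod fun U => ?_
  obtain ⟨r, hr⟩ := exists_isUniversal_of_adjunction (H U).some
  obtain ⟨r', hr'⟩ := exists_isUniversal_of_adjunction (H (U ⨯ X)).some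
  exact hr.of_point (.of_prod U X) hr' _

lemma exists_isUniversal_of_adjunction {Q : p.Fiber (X ⨯ X)}
    (H : ∀ Y : B, Nonempty (eqFunctor Y Q ⊣ reindex p (pdia Y X))) :
    ∃ l : Loop p X, l.IsUniversal := by
  obtain ⟨r, -⟩ := ElemFib.exists_isUniversal_of_adjunction (H X).some
  let δ : HomOver (dia X) (⊤_ (p.Fiber X)) Q :=
    ((toTopOver (dia X) (⊤_ (p.Fiber X))).comp r).cast (by simp [dia])
  exact ⟨⟨Q, δ.hom, δ.isHomLift⟩, isUniversal_of_adjunction H⟩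

lemma IsUniversal.nonempty_adjunction {l : Loop p X} (H : l.IsUniversal) (Y : B) :
    Nonempty (eqFunctor Y l.obj ⊣ reindex p (pdia Y X)) :=
  ElemFib.IsUniversal.nonempty_adjunction (H (.of_prod Y X))

end Loop

end Points

section CocartesianDiagonals

variable [HasFiniteProducts B] [p.IsFibered] [HasFibredProducts p]

section Reflexivity

variable {X W Z : B} {w : W ⟶ X} {Q : p.Fiber (X ⨯ X)} {r : HomOver (w ≫ dia X) (⊤_ (p.Fiber W)) Q}
  {e : Z ⟶ W} {z : Z ⟶ X} {d : W ⟶ Z} {A : p.Fiber W} {D : p.Fiber Z} {φ : HomOver d A D}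

lemma exists_isReflArrow (r : HomOver (w ≫ dia X) (⊤_ (p.Fiber W)) Q) (hZ : IsBinProd e z)
    (hd₁ : d ≫ e = 𝟙 W) (hd₂ : d ≫ z = w) (A : p.Fiber W) :
    ∃ (K : p.Fiber Z) (k₁ : HomOver e K A) (k₂ : HomOver (prod.lift (e ≫ w) z) K Q)
      (j : HomOver d A K), IsReflArrow r k₁ k₂ j := by
  have hK := isJointlyCart_joint e (prod.lift (e ≫ w) z) A Q
  have hd : 𝟙 W ≫ w ≫ dia X = d ≫ prod.lift (e ≫ w) z := by
    ext <;> simp [dia, hd₂, reassoc_of% hd₁]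
  exact ⟨_, _, _, hK.lift d (.id A) ((toTopOver (𝟙 W) A).comp r) hd₁.symm hd,
    hZ, hd₁, hd₂, hK, hK.lift_fst _ _ _ _ _, hK.lift_snd _ _ _ _ _⟩

lemma IsUniversal.exists_isReflArrow (H : IsUniversal r) (hZ : IsBinProd e z)
    (hd₁ : d ≫ e = 𝟙 W) (hd₂ : d ≫ z = w) (hφ : φ.IsCocart) :
    ∃ (k₁ : HomOver e D A) (k₂ : HomOver (prod.lift (e ≫ w) z) D Q), IsReflArrow r k₁ k₂ φ := by
  obtain ⟨K, k₁, k₂, j, hj⟩ := ElemFib.exists_isReflArrow r hZ hd₁ hd₂ A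
  let κ := hφ.desc j (𝟙 Z)
  have φ_κ : φ.hom ≫ κ.hom = j.hom := hφ.fac _ _ _
  have : IsIso κ.hom := (hφ.of_comp ((H hj).congr φ_κ.symm)).isIso
  refine ⟨(κ.comp k₁).cast, (κ.comp k₂).cast, hZ, hd₁, hd₂, ?_, ?_, ?_⟩
  · exact hj.isJointlyCart.pullback (.of_isIso κ) (.id A) (by simp) (by simp) (by simp) rfl
  · simp [reassoc_of% φ_κ, hj.hom_fst]
  · simp [reassoc_of% φ_κ, hj.hom_snd]

lemma IsReflArrow.pullback {k₁ : HomOver e D A} {k₂ : HomOver (prod.lift (e ≫ w) z) D Q}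
    (h : IsReflArrow r k₁ k₂ φ) {W' Z' : B} {gW : W' ⟶ W} {gZ : Z' ⟶ Z} {e' : Z' ⟶ W'}
    {d' : W' ⟶ Z'} {A' : p.Fiber W'} {D' : p.Fiber Z'} {α : HomOver gW A' A}
    {β : HomOver gZ D' D} {φ' : HomOver d' A' D'} (hα : α.IsCart) (hβ : β.IsCart)
    (comm : α.hom ≫ φ.hom = φ'.hom ≫ β.hom)
    {r' : HomOver ((gW ≫ w) ≫ dia X) (⊤_ (p.Fiber W')) Q}
    (hr : r'.hom = (toTopOver gW _).hom ≫ r.hom) (hZ' : IsBinProd e' (gZ ≫ z))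
    (hd₁ : d' ≫ e' = 𝟙 W') (hd₂ : d' ≫ gZ ≫ z = gW ≫ w) (he : e' ≫ gW = gZ ≫ e) :
    ∃ (k₁' : HomOver e' D' A') (k₂' : HomOver (prod.lift (e' ≫ gW ≫ w) (gZ ≫ z)) D' Q),
      IsReflArrow r' k₁' k₂' φ' := by
  let k₁' : HomOver e' D' A' := hα.lift (β.comp k₁) e' he.symm
  have k₁'_α : k₁'.hom ≫ α.hom = β.hom ≫ k₁.hom := hα.fac _ _ _
  have base : gZ ≫ prod.lift (e ≫ w) z = prod.lift (e' ≫ gW ≫ w) (gZ ≫ z) := by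
    ext <;> simp [reassoc_of% he]
  refine ⟨k₁', (β.comp k₂).cast base, hZ', hd₁, hd₂, ?_, ?_, ?_⟩
  · exact h.isJointlyCart.pullback hβ hα he base.symm k₁'_α rfl
  · refine hα.ext (φ'.comp k₁') (.id A') ?_ hd₁
    rw [HomOver.comp_hom, Category.assoc, k₁'_α, ← reassoc_of% comm, h.hom_fst]
    simp
  · rw [HomOver.cast_hom, HomOver.comp_hom, ← reassoc_of% comm, h.hom_snd, hr,
      comp_toTopOver_assoc, comp_toTopOver_assoc]
    exact congrArg (· ≫ r.hom) (top_ext _ _)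

end Reflexivity

namespace Loop

variable {l : ∀ X : B, Loop p X}

lemma hasCocartLifts_of_isUniversal (H : ∀ X, (l X).IsUniversal) :
    HasCocartLifts p (ParamDiag (C := B)) := by
  rintro W Z d ⟨Y, X, w₁, w, e, z, hw, hZ, hd₁, hd₂⟩ A
  obtain ⟨K, _, _, j, hj⟩ := exists_isReflArrow ((l X).refl w) hZ hd₁ hd₂ A
  exact ⟨K, j.hom, H X hw hj⟩

end Loop

end CocartesianDiagonals

section ProductStability

/-- Multiplying the parametrised diagonal `f : Y ⟶ X` with `V` gives a diagonal with the extra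
parameter `V`. -/
lemma IsProdMap.exists_diag {V Y X S VY VX : B} {f : Y ⟶ X} {y : Y ⟶ S} {x₁ : X ⟶ Y}
    {x : X ⟶ S} (hx : IsBinProd x₁ x) (hf₁ : f ≫ x₁ = 𝟙 Y) (hf₂ : f ≫ x = y)
    {b₁ : VY ⟶ V} {b₂ : VY ⟶ Y} {d₁ : VX ⟶ V} {d₂ : VX ⟶ X} (hb : IsBinProd b₁ b₂)
    (hd : IsBinProd d₁ d₂) {Vf : VY ⟶ VX} (hVf : IsProdMap b₁ b₂ d₁ d₂ (𝟙 V) f Vf) :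
    ∃ e : VX ⟶ VY, e ≫ b₁ = d₁ ∧ e ≫ b₂ = d₂ ≫ x₁ ∧ IsBinProd e (d₂ ≫ x) ∧ Vf ≫ e = 𝟙 VY ∧
      Vf ≫ d₂ ≫ x = b₂ ≫ y := by
  obtain ⟨hVf₁, hVf₂⟩ := hVf
  refine ⟨hb.lift d₁ (d₂ ≫ x₁), by simp, by simp,
    hx.assoc_right hb hd (by simp) (by simp), hb.hom_ext ?_ ?_, ?_⟩
  · simp [hVf₁]
  · simp [reassoc_of% hVf₂, hf₁]
  · rw [reassoc_of% hVf₂, hf₂]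

variable [HasFiniteProducts B] [p.IsFibered] [HasFibredProducts p]

lemma Loop.productStable_of_isUniversal {l : ∀ X : B, Loop p X} (H : ∀ X, (l X).IsUniversal) :
    ProductStable p ParamDiag (cocartOver p ParamDiag) := by
  rintro U V Y X g f ⟨T, S, y₁, y, x₁, x, hy, hx, hf₁, hf₂⟩ UY VY UX VX a₁ a₂ b₁ b₂ c₁ c₂ d₁ d₂
    ha hb hc hd gY gX Uf Vf ⟨hgY₁, hgY₂⟩ ⟨hgX₁, hgX₂⟩ hUf hVf A' A D' D φ' φ α β hφ' hφ hα hβ comm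
    hΦ
  obtain ⟨eV, eV₁, eV₂, hZ, hdV₁, hdV₂⟩ := hVf.exists_diag hx hf₁ hf₂ hb hd
  obtain ⟨eU, eU₁, eU₂, hZ', hdU₁, hdU₂⟩ := hUf.exists_diag hx hf₁ hf₂ ha hc
  have hV : IsBinProd (prod.lift b₁ (b₂ ≫ y₁)) (b₂ ≫ y) :=
    hy.assoc_right (.of_prod V T) hb (by simp) (by simp)
  have hU : IsBinProd (prod.lift a₁ (a₂ ≫ y₁)) (a₂ ≫ y) :=
    hy.assoc_right (.of_prod U T) ha (by simp) (by simp)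
  rw [Category.comp_id] at hgY₂ hgX₂
  have square : eU ≫ gY = gX ≫ eV := hb.hom_ext
    (by simp [hgY₁, reassoc_of% eU₁, eV₁, hgX₁]) (by simp [hgY₂, eU₂, eV₂, reassoc_of% hgX₂])
  let φ₀ : HomOver Vf (.mk (IsHomLift.domain_eq p Vf φ)) (.mk (IsHomLift.codomain_eq p Vf φ)) :=
    ⟨φ, hφ⟩
  let φ₀' : HomOver Uf (.mk (IsHomLift.domain_eq p Uf φ'))
    (.mk (IsHomLift.codomain_eq p Uf φ')) := ⟨φ', hφ'⟩
  let α₀ : HomOver gY (.mk (IsHomLift.domain_eq p Uf φ')) (.mk (IsHomLift.domain_eq p Vf φ)) :=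
    ⟨α, hα.toIsHomLift⟩
  let β₀ : HomOver gX (.mk (IsHomLift.codomain_eq p Uf φ'))
    (.mk (IsHomLift.codomain_eq p Vf φ)) := ⟨β, hβ.toIsHomLift⟩
  obtain ⟨k₁, k₂, hk⟩ := (H S hV).exists_isReflArrow hZ hdV₁ hdV₂ (φ₀.cocartOver_iff.1 hΦ).1
  have hw : gY ≫ b₂ ≫ y = a₂ ≫ y := by rw [reassoc_of% hgY₂]
  have hz : gX ≫ d₂ ≫ x = c₂ ≫ x := by rw [reassoc_of% hgX₂]
  rw [← hw] at hU
  obtain ⟨k₁', k₂', hk'⟩ := hk.pullback (α := α₀) (β := β₀) (φ' := φ₀') hα hβ comm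
    (r' := (l S).refl (gY ≫ b₂ ≫ y)) ((l S).toTopOver_comp_refl gY _ _).symm (hz ▸ hZ') hdU₁
    (by rw [hz, hw, hdU₂]) square
  exact φ₀'.cocartOver_iff.2 ⟨H S hU hk', _, S, _, _, eU, c₂ ≫ x, hU, hZ', hdU₁, hw ▸ hdU₂⟩

end ProductStability

section Pairability

variable [HasFiniteProducts B] [p.IsFibered] [HasFibredProducts p]

namespace IsUniversal

section TransportBijective

variable {X U W : B} {w : W ⟶ X} {Q : p.Fiber (X ⨯ X)}
  {r : HomOver (w ≫ dia X) (⊤_ (p.Fiber W)) Q} {w₁ : W ⟶ U} {A : p.Fiber W} {Γ : B} {G : p.Fiber Γ}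
  {f f' : Γ ⟶ W} {g : Γ ⟶ X ⨯ X}

lemma transport_injective (H : IsUniversal r) (hw : IsBinProd w₁ w) (e : HomOver g G Q)
    (hg : g ≫ prod.fst = f ≫ w) {a a' : HomOver f G A}
    (h : (H.transport hw a e hg).hom = (H.transport hw a' e hg).hom) : a.hom = a'.hom := by
  rw [← H.transport_transport_reverse hw a e hg, ← H.transport_transport_reverse hw a' e hg,
    HomOver.ext h]

lemma exists_transport_eq (H : IsUniversal r) (hw : IsBinProd w₁ w) (a : HomOver f' G A)
    (e : HomOver g G Q) (hg : g ≫ prod.fst = f ≫ w) (hg' : g ≫ prod.snd = f' ≫ w)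
    (hf : f' ≫ w₁ = f ≫ w₁) : ∃ v : HomOver f G A, (H.transport hw v e hg).hom = a.hom := by
  refine ⟨(H.transport hw a (H.reverse f e hg) (by simp [hg'])).cast
    (hw.hom_ext (by simp [hf]) (by simp [hg])),
    Eq.trans ?_ (H.transport_reverse_transport hw a e hg hg' hf)⟩
  exact (Category.id_comp _).symm.trans
    (H.comp_transport hw (.id G) (by simp) (by simp) (hw.hom_ext (by simp [hf]) (by simp [hg])))

end TransportBijective

section Pairs

variable {X W Z : B} {w : W ⟶ X} {e : Z ⟶ W} {z : Z ⟶ X} {d : W ⟶ Z} {Q : p.Fiber (X ⨯ X)}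
  {s : HomOver (z ≫ dia X) (⊤_ (p.Fiber Z)) Q} {A C' P : p.Fiber W} {D C R : p.Fiber Z}
  {k₁ : HomOver e D A} {k₂ : HomOver (prod.lift (e ≫ w) z) D Q} {ψ : HomOver d C' C} {π₁ : P ⟶ A}
  {π₂ : P ⟶ C'} {π₁' : R ⟶ D} {π₂' : R ⟶ C} {q : HomOver (prod.lift (e ≫ w) z) R Q}
  {v : HomOver (e ≫ d) R C} {ι : HomOver e R P}

/-- Since `C' = d^* C`, the pair `(ι, q)` consists of an element `v` of `C` at the source of the
equality `q`, and an element of `A`; transport along `q` trades `v` for an element of `C` at the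
target. -/
lemma isJointlyCart_pair (S : IsUniversal s) (hZ : IsBinProd e z) (hde : d ≫ e = 𝟙 W)
    (hdz : d ≫ z = w) (hk : IsJointlyCart k₁ k₂) (hψ : ψ.IsCart) (hP : IsBinProd π₁ π₂)
    (hR : IsBinProd π₁' π₂') (hq : q.hom = und π₁' ≫ k₂.hom)
    (hv : (S.transport hZ v q (by simp [hdz])).hom = und π₂')
    (hι₁ : ι.hom ≫ und π₁ = und π₁' ≫ k₁.hom) (hι₂ : ι.hom ≫ und π₂ ≫ ψ.hom = v.hom) :
    IsJointlyCart ι q where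
  exists_lift {Γ G} h φ₁ φ₂ := by
    let c : HomOver (h ≫ e ≫ d) G C := (φ₁.comp ((HomOver.ofFiber π₂).comp ψ)).cast
    let t₁ : HomOver h G D := hk.lift h (φ₁.comp (.ofFiber π₁)) φ₂
    have t₁_k₁ : t₁.hom ≫ k₁.hom = φ₁.hom ≫ und π₁ := hk.lift_fst _ _ _ _ _
    have t₁_k₂ : t₁.hom ≫ k₂.hom = φ₂.hom := hk.lift_snd _ _ _ _ _
    let t₂ : HomOver h G C := (S.transport hZ c φ₂ (by simp [hdz])).cast
      (hZ.hom_ext (by simp [hde]) (by simp))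
    let t : HomOver h G R := hR.isJointlyCart.lift h t₁ t₂
    have t_π₁ : t.hom ≫ und π₁' = t₁.hom := hR.isJointlyCart.lift_fst _ _ _ _ _
    have t_π₂ : t.hom ≫ und π₂' = t₂.hom := hR.isJointlyCart.lift_snd _ _ _ _ _
    have t_q : t.hom ≫ q.hom = φ₂.hom := by rw [hq, reassoc_of% t_π₁, t₁_k₂]
    have t_v : t.hom ≫ v.hom = c.hom := by
      refine S.transport_injective hZ φ₂ (a := t.comp v) (by simp [hdz]) ?_
      rw [← S.comp_transport hZ t (a := v) (e := q) (hg := by simp [hdz]) rfl t_q, hv, t_π₂]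
      rfl
    refine ⟨t, hP.isJointlyCart.ext (t.comp ι) φ₁ ?_ ?_, t_q⟩
    · simp [hι₁, reassoc_of% t_π₁, t₁_k₁]
    · refine hψ.ext ((t.comp ι).comp (.ofFiber π₂)) (φ₁.comp (.ofFiber π₂)) ?_
      simp [hι₂, t_v, c]
  uniq {Γ G} h φ φ' e₁ e₂ := by
    refine hR.isJointlyCart.ext φ φ'
      (hk.ext (φ.comp (.ofFiber π₁')) (φ'.comp (.ofFiber π₁')) ?_ ?_) ?_
    · simp [← hι₁, reassoc_of% e₁]
    · simpa [← hq] using e₂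
    · rw [HomOver.ofFiber_hom, ← hv]
      have e_v : φ.hom ≫ v.hom = φ'.hom ≫ v.hom := by rw [← hι₂, reassoc_of% e₁]
      exact (S.comp_transport hZ φ (a' := φ'.comp v) (e' := φ'.comp q) (hg' := by simp [hdz]) e_v
        e₂).trans (S.comp_transport hZ φ' rfl rfl).symm

end Pairs

end IsUniversal

namespace Loop

variable {X U W Z : B} {l : Loop p X} {w₁ : W ⟶ U} {w : W ⟶ X} {e : Z ⟶ W} {z : Z ⟶ X} {d : W ⟶ Z}
  {A C' P : p.Fiber W} {D C R : p.Fiber Z} {φ : HomOver d A D} {ψ : HomOver d C' C} {π₁ : P ⟶ A}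
  {π₂ : P ⟶ C'} {π₁' : R ⟶ D} {π₂' : R ⟶ C} {χ : HomOver d P R} {k₁ : HomOver e D A}
  {k₂ : HomOver (prod.lift (e ≫ w) z) D l.obj}

lemma IsUniversal.exists_isReflArrow_pair (H : l.IsUniversal)
    (h : IsReflArrow (l.refl w) k₁ k₂ φ) (hψ : ψ.IsCart) (hP : IsBinProd π₁ π₂)
    (hR : IsBinProd π₁' π₂') (h₁ : χ.hom ≫ und π₁' = und π₁ ≫ φ.hom)
    (h₂ : χ.hom ≫ und π₂' = und π₂ ≫ ψ.hom) :
    ∃ (ι : HomOver e R P) (q : HomOver (prod.lift (e ≫ w) z) R l.obj),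
      IsReflArrow (l.refl w) ι q χ := by
  have hZ := h.isBinProd
  have hde := h.comp_fst
  have hdz := h.comp_snd
  let q : HomOver (prod.lift (e ≫ w) z) R l.obj := ((HomOver.ofFiber π₁').comp k₂).cast
  have χ_q : χ.hom ≫ q.hom = (toTopOver (𝟙 W) P).hom ≫ (l.refl w).hom := by
    simp only [q, HomOver.cast_hom, HomOver.comp_hom, HomOver.ofFiber_hom, reassoc_of% h₁,
      h.hom_snd, reassoc_of% toTopOver_naturality]
  obtain ⟨v, hv⟩ := (H hZ).exists_transport_eq hZ (f := e ≫ d) (f' := 𝟙 Z)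
    (HomOver.ofFiber π₂') q (by simp [hdz]) (by simp) (by simp [hde])
  have χ_v : χ.hom ≫ v.hom = und π₂ ≫ ψ.hom := by
    rw [← h₂]
    refine ((H hZ).comp_transport_of_refl hZ χ (hg := by simp [hdz]) ?_ ?_).symm.trans
      (congrArg (χ.hom ≫ ·) hv)
    · rw [χ_q, toTopOver_comp_refl, toTopOver_comp_refl]
      exact congrArg (· ≫ l.arr) (top_ext _ _ (by simp [reassoc_of% hde, hdz]))
    · ext <;> simp [reassoc_of% hde, hdz]
  let ι : HomOver e R P :=
    hP.isJointlyCart.lift e ((HomOver.ofFiber π₁').comp k₁) (hψ.lift v e)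
  have ι_π₁ : ι.hom ≫ und π₁ = und π₁' ≫ k₁.hom := hP.isJointlyCart.lift_fst _ _ _ _ _
  have ι_ψ : ι.hom ≫ und π₂ ≫ ψ.hom = v.hom :=
    (hP.isJointlyCart.lift_snd_assoc _ _ _ _ _ _).trans (hψ.fac _ _ _)
  refine ⟨ι, q, hZ, hde, hdz, (H hZ).isJointlyCart_pair hZ hde hdz h.isJointlyCart hψ hP hR rfl hv
    ι_π₁ ι_ψ, hP.isJointlyCart.ext (χ.comp ι) (.id P) ?_ (hψ.ext ((χ.comp ι).comp (.ofFiber π₂))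
    ((HomOver.id P).comp (.ofFiber π₂)) ?_ (by simp [hde])) hde, χ_q⟩
  · simp [ι_π₁, reassoc_of% h₁, h.hom_fst]
  · simp [ι_ψ, χ_v]

lemma pairable_of_isUniversal {l : ∀ X : B, Loop p X} (H : ∀ X, (l X).IsUniversal) :
    Pairable p (cocartOver p ParamDiag) := by
  intro W Z d A C' P D C R φ ψ π₁ π₂ π₁' π₂' χ hφ hψ hP hR hχ h₁ h₂ hΦ
  let φ₀ : HomOver d A D := ⟨φ, hφ⟩
  let ψ₀ : HomOver d C' C := ⟨ψ, hψ.toIsHomLift⟩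
  let χ₀ : HomOver d P R := ⟨χ, hχ⟩
  obtain ⟨hφ₀, hd⟩ := φ₀.cocartOver_iff.1 hΦ
  refine χ₀.cocartOver_iff.2 ⟨?_, hd⟩
  obtain ⟨Y, X, w₁, w, e, z, hw, hZ, hd₁, hd₂⟩ := hd
  obtain ⟨k₁, k₂, hk⟩ := (H X hw).exists_isReflArrow hZ hd₁ hd₂ hφ₀
  obtain ⟨ι, q, h⟩ := (H X).exists_isReflArrow_pair (ψ := ψ₀) (χ := χ₀) hk hψ hP hR h₁ h₂
  exact H X hw h

end Loop

end Pairability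

section Elementary

lemma HomOver.IsCocart.isIso_of_fac {X Y : B} {f : X ⟶ Y} {A : p.Fiber X} {D D' : p.Fiber Y}
    {φ : HomOver f A D} {ψ : HomOver f A D'} (hφ : φ.IsCocart) (hψ : ψ.IsCocart) {χ : D ⟶ D'}
    (h : φ.hom ≫ und χ = ψ.hom) : IsIso χ := by
  have : IsIso (HomOver.ofFiber χ).hom := (hφ.of_comp (ψ := .ofFiber χ) (hψ.congr h.symm)).isIso
  exact ⟨(HomOver.ofFiber χ).inv.cast.toFiber, und_ext (by simp), und_ext (by simp)⟩

variable [p.IsFibered]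

lemma reindexSq_comp {W X Y Z : B} {a : W ⟶ X} {b : X ⟶ Z} {c : W ⟶ Y} {d : Y ⟶ Z}
    (w : a ≫ b = c ≫ d) (D : p.Fiber Z) :
    und (reindexSq p w D) ≫ (reindexHom a _).hom ≫ (reindexHom b D).hom =
      (reindexHom c _).hom ≫ (reindexHom d D).hom := by
  rw [← Category.assoc]
  exact (congrArg (· ≫ cart p b D) (cartLift_cart p (Category.id_comp a).symm _ _)).trans
    (cartLift_cart p _ _ _)

lemma unitOver_comp_beckChevalley {W X Y Z : B} {a : W ⟶ X} {b : X ⟶ Z} {c : W ⟶ Y} {d : Y ⟶ Z}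
    (w : a ≫ b = c ≫ d) {L : p.Fiber W ⥤ p.Fiber X} {L' : p.Fiber Y ⥤ p.Fiber Z}
    (adj : L ⊣ reindex p a) (adj' : L' ⊣ reindex p d) (A : p.Fiber Y) :
    (unitOver adj ((reindex p c).obj A)).hom ≫ und (beckChevalley p w adj adj' A) ≫
      (reindexHom b _).hom = (reindexHom c A).hom ≫ (unitOver adj' A).hom := by
  rw [← Category.assoc, beckChevalley, unitOver_comp_und, Equiv.apply_symm_apply, und_comp,
    Category.assoc, Category.assoc, reindexSq_comp, ← Category.assoc]
  exact (congrArg (· ≫ (reindexHom d _).hom) (reindexHom_comp_und c (adj'.unit.app A))).symm.trans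
    (Category.assoc _ _ _)

section Frobenius

variable [HasFibredProducts p] {X Y : B} {f : X ⟶ Y} {L : p.Fiber X ⥤ p.Fiber Y}
  (adj : L ⊣ reindex p f) (D : p.Fiber Y) (A : p.Fiber X)

lemma unitOver_comp_frobenius_fst :
    (unitOver adj ((reindex p f).obj D ⨯ A)).hom ≫ und (frobenius p adj D A) ≫ und prod.fst =
      und prod.fst ≫ (reindexHom f D).hom := by
  rw [← und_comp, frobenius, prod.lift_fst, ← Adjunction.homEquiv_counit, unitOver_comp_und,
    Equiv.apply_symm_apply]

lemma unitOver_comp_frobenius_snd :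
    (unitOver adj ((reindex p f).obj D ⨯ A)).hom ≫ und (frobenius p adj D A) ≫ und prod.snd =
      und prod.snd ≫ (unitOver adj A).hom := by
  rw [← und_comp, frobenius, prod.lift_snd, unitOver_naturality]

lemma isIso_frobenius {Θ : MorphismProperty B} (pairable : Pairable p (cocartOver p Θ))
    (hf : Θ f) : IsIso (frobenius p adj D A) := by
  let n : HomOver f ((reindex p f).obj D ⨯ A) (D ⨯ L.obj A) :=
    ((unitOver adj _).comp (.ofFiber (frobenius p adj D A))).cast
  have n_fst : n.hom ≫ und prod.fst = und prod.fst ≫ (reindexHom f D).hom :=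
    (Category.assoc _ _ _).trans (unitOver_comp_frobenius_fst adj D A)
  have n_snd : n.hom ≫ und prod.snd = und prod.snd ≫ (unitOver adj A).hom :=
    (Category.assoc _ _ _).trans (unitOver_comp_frobenius_snd adj D A)
  have hn : cocartOver p Θ n.hom :=
    pairable f (unitOver adj A).hom (reindexHom f D).hom prod.snd prod.fst prod.snd prod.fst n.hom
      (unitOver adj A).isHomLift (isCart_reindexHom f D) (IsBinProd.of_prod _ _).symm
      (IsBinProd.of_prod _ _).symm n.isHomLift n_snd n_fst
      ((unitOver adj A).cocartOver_iff.2 ⟨isCocart_unitOver adj A, hf⟩)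
  exact (isCocart_unitOver adj _).isIso_of_fac (n.cocartOver_iff.1 hn).1 rfl

end Frobenius

variable [HasFiniteProducts B]

lemma isIso_beckChevalley (stable : ProductStable p ParamDiag (cocartOver p ParamDiag)) {Y Z X : B}
    (f : Y ⟶ Z) {L : p.Fiber (Y ⨯ X) ⥤ p.Fiber ((Y ⨯ X) ⨯ X)}
    {L' : p.Fiber (Z ⨯ X) ⥤ p.Fiber ((Z ⨯ X) ⨯ X)} (adj : L ⊣ reindex p (pdia Y X))
    (adj' : L' ⊣ reindex p (pdia Z X)) (A : p.Fiber (Z ⨯ X)) :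
    IsIso (beckChevalley p (pdia_square f X) adj adj' A) := by
  let n : HomOver (pdia Y X) _ _ :=
    ((unitOver adj _).comp (.ofFiber (beckChevalley p (pdia_square f X) adj adj' A))).cast
  have comm : (reindexHom (prod.map f (𝟙 X)) A).hom ≫ (unitOver adj' A).hom =
      n.hom ≫ (reindexHom (prod.map (prod.map f (𝟙 X)) (𝟙 X)) _).hom :=
    ((Category.assoc _ _ _).trans
      (unitOver_comp_beckChevalley (pdia_square f X) adj adj' A)).symm
  have isBinProd_assoc (V : B) : IsBinProd (prod.fst ≫ prod.fst : (V ⨯ X) ⨯ X ⟶ V)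
      (prod.lift (prod.fst ≫ prod.snd) prod.snd : (V ⨯ X) ⨯ X ⟶ X ⨯ X) :=
    (IsBinProd.of_prod _ _).assoc_left (.of_prod _ _)
  have isProdMap_pdia (V : B) : IsProdMap (prod.fst : V ⨯ X ⟶ V) prod.snd (prod.fst ≫ prod.fst)
      (prod.lift (prod.fst ≫ prod.snd) prod.snd) (𝟙 V) (dia X) (pdia V X) :=
    ⟨by simp [pdia], by ext <;> simp [pdia, dia]⟩
  have hn : cocartOver p ParamDiag n.hom :=
    stable f (dia X) (paramDiag_dia X) _ _ _ _ _ _ _ _ (.of_prod Y X) (.of_prod Z X)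
      (isBinProd_assoc Y) (isBinProd_assoc Z) (prod.map f (𝟙 X))
      (prod.map (prod.map f (𝟙 X)) (𝟙 X)) (pdia Y X) (pdia Z X) ⟨by simp, by simp⟩
      ⟨by simp, by ext <;> simp⟩ (isProdMap_pdia Y) (isProdMap_pdia Z) n.hom
      (unitOver adj' A).hom _ _ n.isHomLift (unitOver adj' A).isHomLift
      (isCart_reindexHom _ A) (isCart_reindexHom _ _) comm
      ((unitOver adj' A).cocartOver_iff.2 ⟨isCocart_unitOver adj' A, paramDiag_pdia Z X⟩)
  exact (isCocart_unitOver adj _).isIso_of_fac (n.cocartOver_iff.1 hn).1 rfl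

lemma isElementary_of_isUniversal [HasFibredProducts p] {l : ∀ X : B, Loop p X}
    (H : ∀ X, (l X).IsUniversal) : IsElementary p :=
  ⟨_, fun Y X => ((H X).nonempty_adjunction Y).some,
    fun Y X A D => isIso_frobenius _ D A (Loop.pairable_of_isUniversal H) (paramDiag_pdia Y X),
    fun _ _ _ f A => isIso_beckChevalley (Loop.productStable_of_isUniversal H) f _ _ A⟩

end Elementary

section LoopsOfElementary

variable [p.IsFibered]

lemma exists_isCart_of_isIso_beckChevalley {W X Y Z : B} {a : W ⟶ X} {b : X ⟶ Z} {c : W ⟶ Y}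
    {d : Y ⟶ Z} (w : a ≫ b = c ≫ d) {L : p.Fiber W ⥤ p.Fiber X} {L' : p.Fiber Y ⥤ p.Fiber Z}
    (adj : L ⊣ reindex p a) (adj' : L' ⊣ reindex p d) (A : p.Fiber Y)
    [IsIso (beckChevalley p w adj adj' A)] :
    ∃ β : HomOver b (L.obj ((reindex p c).obj A)) (L'.obj A), β.IsCart ∧
      (unitOver adj _).hom ≫ β.hom = (reindexHom c A).hom ≫ (unitOver adj' A).hom := by
  let χ := HomOver.ofFiber (beckChevalley p w adj adj' A)
  have : IsIso χ.hom := inferInstanceAs (IsIso (Fiber.fiberInclusion.map _))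
  exact ⟨(χ.comp (reindexHom b _)).cast,
    ((HomOver.IsCart.of_isIso χ).comp (isCart_reindexHom b _)).congr rfl,
    unitOver_comp_beckChevalley w adj adj' A⟩

variable [HasFibredProducts p]

lemma exists_isCocart_of_isIso_frobenius {X Y : B} {f : X ⟶ Y} {L : p.Fiber X ⥤ p.Fiber Y}
    (adj : L ⊣ reindex p f) (D : p.Fiber Y) (A : p.Fiber X) [IsIso (frobenius p adj D A)] :
    ∃ n : HomOver f ((reindex p f).obj D ⨯ A) (D ⨯ L.obj A), n.IsCocart ∧
      n.hom ≫ und prod.fst = und prod.fst ≫ (reindexHom f D).hom ∧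
      n.hom ≫ und prod.snd = und prod.snd ≫ (unitOver adj A).hom := by
  let χ := HomOver.ofFiber (frobenius p adj D A)
  have : IsIso χ.hom := inferInstanceAs (IsIso (Fiber.fiberInclusion.map _))
  exact ⟨((unitOver adj _).comp χ).cast,
    ((isCocart_unitOver adj _).comp (.of_isIso χ)).congr rfl,
    (Category.assoc _ _ _).trans (unitOver_comp_frobenius_fst adj D A),
    (Category.assoc _ _ _).trans (unitOver_comp_frobenius_snd adj D A)⟩

variable [HasFiniteProducts B] {X : B}

/-- As `d^* e^* A ∧ T` is isomorphic to `A`, Frobenius reciprocity for `e^* A` reduces the universal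
property at `A` to that of the unit at the terminal object `T`. -/
lemma isUniversal_of_isIso_frobenius {W Z X' : B} {w : W ⟶ X} {e : Z ⟶ W} {z : Z ⟶ X} {d : W ⟶ Z}
    (hZ : IsBinProd e z) (hd₁ : d ≫ e = 𝟙 W) (hd₂ : d ≫ z = w) {L : p.Fiber W ⥤ p.Fiber Z}
    (adj : L ⊣ reindex p d) {T : p.Fiber W} (frob : ∀ D, IsIso (frobenius p adj D T)) {c : W ⟶ X'}
    {α : HomOver c T (⊤_ (p.Fiber X'))} (hα : α.IsCart) {Q : p.Fiber (X ⨯ X)}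
    {r : HomOver (w ≫ dia X) (⊤_ (p.Fiber W)) Q}
    {ν : HomOver (prod.lift (e ≫ w) z) (L.obj T) Q} (hν : ν.IsCart)
    (hr : (unitOver adj T).hom ≫ ν.hom = (toTopOver (𝟙 W) T).hom ≫ r.hom) : IsUniversal r := by
  refine .of_isReflArrow (e := e) (z := z) (d := d) fun A => ?_
  let ρ := reindexHom e A
  let D := (reindex p e).obj A
  obtain ⟨n, hn, n_fst, n_snd⟩ := exists_isCocart_of_isIso_frobenius adj D T
  let P := (reindex p d).obj D ⨯ T
  let g : HomOver (𝟙 W) P A :=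
    (((HomOver.ofFiber prod.fst).comp (reindexHom d D)).comp ρ).cast (by simp [hd₁])
  have hg : g.IsCart := by
    have : IsIso (HomOver.ofFiber (prod.fst : P ⟶ _)).hom := (IsBinProd.of_prod _ T).isIso_fst hα
    exact (((HomOver.IsCart.of_isIso (.ofFiber prod.fst)).comp (isCart_reindexHom d D)).comp
      (isCart_reindexHom e A)).congr rfl (by simp [hd₁])
  have : IsIso g.hom := hg.isIso
  refine ⟨D ⨯ L.obj T, ((HomOver.ofFiber prod.fst).comp ρ).cast,
    ((HomOver.ofFiber prod.snd).comp ν).cast, (g.inv.comp n).cast, ⟨hZ, hd₁, hd₂, ?_, ?_, ?_⟩,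
    ((HomOver.IsCocart.of_isIso g.inv).comp hn).congr rfl⟩
  · exact (IsBinProd.of_prod D _).isJointlyCart.comp_cart (isCart_reindexHom e A) hν rfl rfl
  · have n_g : n.hom ≫ und prod.fst ≫ ρ.hom = g.hom := by
      simpa [g, ρ] using congrArg (· ≫ ρ.hom) n_fst
    exact (Category.assoc _ _ _).trans ((congrArg (g.inv.hom ≫ ·) n_g).trans
      (IsIso.inv_hom_id g.hom))
  · simp only [HomOver.cast_hom, HomOver.comp_hom, HomOver.ofFiber_hom, Category.assoc,
      reassoc_of% n_snd, hr]
    exact ((Category.assoc _ _ _).trans (Category.assoc _ _ _)).symm.trans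
      (congrArg (· ≫ r.hom) (top_ext ((g.inv.comp (.ofFiber prod.snd)).comp (toTopOver (𝟙 W) T)) _
        (by simp)))

lemma IsElementary.exists_isUniversal (h : IsElementary p) (X : B) :
    ∃ l : Loop p X, l.IsUniversal := by
  obtain ⟨L, adj, frob, bc⟩ := h
  let u₀ := unitOver (adj (⊤_ B) X) (⊤_ (p.Fiber ((⊤_ B) ⨯ X)))
  let s : X ⟶ (⊤_ B) ⨯ X := prod.lift (terminal.from X) (𝟙 X)
  let k : X ⨯ X ⟶ ((⊤_ B) ⨯ X) ⨯ X := prod.lift (prod.fst ≫ s) prod.snd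
  have hk := isCart_reindexHom k ((L (⊤_ B) X).obj (⊤_ _))
  let δ := hk.lift ((toTopOver s (⊤_ (p.Fiber X))).comp u₀) (dia X)
    (by ext <;> simp [s, k, pdia, dia])
  have hδ : δ.hom ≫ (reindexHom k _).hom = (toTopOver s _).hom ≫ u₀.hom := hk.fac _ _ _
  let l : Loop p X := ⟨_, δ.hom, δ.isHomLift⟩
  refine ⟨l, .of_prod fun U => ?_⟩
  let c : U ⨯ X ⟶ (⊤_ B) ⨯ X := prod.map (terminal.from U) (𝟙 X)
  have := bc U (⊤_ B) X (terminal.from U) (⊤_ _)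
  obtain ⟨β, hβ, u_β⟩ := exists_isCart_of_isIso_beckChevalley (pdia_square (terminal.from U) X)
    (adj U X) (adj (⊤_ B) X) (⊤_ _)
  have hb : prod.map c (𝟙 X) = pr23 U X ≫ k :=
    Limits.prod.hom_ext (Limits.prod.hom_ext (Subsingleton.elim _ _) (by simp [c, k, s, pr23]))
      (by simp [k, pr23])
  let ν : HomOver (pr23 U X) _ l.obj := hk.lift β (pr23 U X) hb
  have ν_k : ν.hom ≫ (reindexHom k _).hom = β.hom := hk.fac _ _ _
  have hν : ν.IsCart := .of_comp hk (hβ.congr ν_k.symm hb)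
  refine isUniversal_of_isIso_frobenius (.of_prod (U ⨯ X) X) (prod.lift_fst _ _)
    (prod.lift_snd _ _) (adj U X) (fun D => frob U X _ D) (isCart_reindexHom c (⊤_ _)) hν ?_
  refine hk.ext ((unitOver (adj U X) _).comp ν) ((toTopOver (𝟙 _) _).comp (l.refl prod.snd)) ?_
    (by ext <;> simp [pdia, pr23, dia])
  rw [HomOver.comp_hom, HomOver.comp_hom, Loop.toTopOver_comp_refl, Category.assoc, Category.assoc,
    ν_k, u_β, hδ, comp_toTopOver_assoc]
  exact congrArg (· ≫ u₀.hom) (top_ext _ _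
    (Limits.prod.hom_ext (Subsingleton.elim _ _) (by simp [s])))

end LoopsOfElementary

end ElemFib

open CategoryTheory CategoryTheory.Limits CategoryTheory.Functor ElemFib

theorem theorem4p7 {B : Type*} [Category* B] {E : Type*} [Category* E] (p : E ⥤ B)
    [p.IsFibered] [HasFiniteProducts B] [HasFibredProducts p] :
    List.TFAE [
      IsElementary p,
      HasCocartLifts p (ParamDiag (C := B)) ∧
        (ProductStable p ParamDiag (cocartOver p ParamDiag) ∧
          Pairable p (cocartOver p ParamDiag)),
      (∀ X : B, ∃ (Q : p.Fiber (X ⨯ X)) (d : tot (⊤_ (p.Fiber X)) ⟶ tot Q),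
          p.IsStronglyCocartesian (dia X) d) ∧
        (ProductStable p ParamDiag (cocartOver p ParamDiag) ∧
          Pairable p (cocartOver p ParamDiag)),
      ∃ T : ∀ X : B, StrictTransporter p X,
        StrictlyProductive (fun X => (T X).toLoop) ∧
        ∀ (X : B) {a b : E} (ψ : a ⟶ b), (T X).toLoop.BCFRClass ψ →
          fibEpic p ψ ∧ ParamDiag (p.map ψ),
      ∃ l : ∀ X : B, Loop p X,
        ∀ (X : B) {a b : E} (ψ : a ⟶ b), (l X).BCFRClass ψ → cocartOver p ParamDiag ψ,
      ∃ Q : ∀ X : B, p.Fiber (X ⨯ X),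
        ∀ Y X : B, Nonempty (eqFunctor Y (Q X) ⊣ reindex p (pdia Y X))] := by
  tfae_have 1 → 5 := fun h => by
    choose l hl using h.exists_isUniversal
    exact ⟨l, fun X => Loop.isUniversal_iff_bcfrClass.1 (hl X)⟩
  tfae_have 5 → 1 := fun ⟨_, h⟩ =>
    isElementary_of_isUniversal fun X => Loop.isUniversal_iff_bcfrClass.2 (h X)
  tfae_have 5 → 2 := fun ⟨l, h⟩ =>
    have H (X : B) : (l X).IsUniversal := Loop.isUniversal_iff_bcfrClass.2 (h X)
    ⟨Loop.hasCocartLifts_of_isUniversal H, Loop.productStable_of_isUniversal H,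
      Loop.pairable_of_isUniversal H⟩
  tfae_have 2 → 3 := fun ⟨h, h'⟩ => ⟨fun X => h (dia X) (paramDiag_dia X) _, h'⟩
  tfae_have 3 → 5 := fun ⟨h, stable, pairable⟩ => by
    choose Q d hd using h
    exact ⟨fun X => ⟨Q X, d X, (hd X).toIsHomLift⟩, fun X => Loop.isUniversal_iff_bcfrClass.1
      (Loop.IsUniversal.of_productStable_of_pairable stable pairable (hd X))⟩
  tfae_have 5 → 4 := fun ⟨l, h⟩ =>
    Loop.exists_strictlyProductive fun X => Loop.isUniversal_iff_bcfrClass.2 (h X)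
  tfae_have 4 → 5 := fun ⟨T, hT, h⟩ => ⟨fun X => (T X).toLoop, fun X =>
    Loop.isUniversal_iff_bcfrClass.1 <|
      Loop.isUniversal_of_strictTransporter T hT fun ψ hψ => (h X ψ hψ).1⟩
  tfae_have 5 → 6 := fun ⟨l, h⟩ => ⟨fun X => (l X).obj, fun Y X =>
    (Loop.isUniversal_iff_bcfrClass.2 (h X)).nonempty_adjunction Y⟩
  tfae_have 6 → 5 := fun ⟨Q, h⟩ => by
    choose l hl using fun X => Loop.exists_isUniversal_of_adjunction fun Y => h Y X
    exact ⟨l, fun X => Loop.isUniversal_iff_bcfrClass.1 (hl X)⟩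
  tfae_finish
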